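/- Let $L\ge 1$ and let $p_1,p_2,p_3\in\mathbb{C}^4$ be complexified external momenta with $p_1+p_2+p_3=0$, where $q^2=(q^0)^2-(q^1)^2-(q^2)^2-(q^3)^2$. Assume that they are off-shell, $p_i^2\neq 0$ for $i=1,2,3$, and that $\lambda_K\big(1,\tfrac{p_1^2}{p_3^2},\tfrac{p_2^2}{p_3^2}\big)\ne 0$, where $\lambda_K(x,y,z)=x^2+y^2+z^2-2xy-2yz-2zx$. Consider the four-dimensional Feynman integral of the $L$-loop planar ladder triangle with massless propagators, $$J^{(L)}=\int\prod_{i=1}^{L}\frac{d^4\ell_i}{i\pi^2}\,\frac{1}{(\ell_i-p_1)^2(\ell_i+p_2)^2(\ell_{i-1}-\ell_i)^2},\qquad \ell_0=0$$ (where the $i$ in $i\pi^2$ is the imaginary unit). A leading singularity of $J^{(L)}$ is a nonzero number obtained from its integrand, regarded as a meromorphic differential form of degree $4L$ on $\mathbb{C}^{4L}$, by taking $4L$ successive residues at first-order poles along a complete flag of hypersurfaces (each one a hypersurface in the preceding one, possibly on a blow-up or a compactification, so that poles produced by Jacobians and poles at infinity are included), in which all $3L$ propagators are cut, each one being a local equation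 of the hypersurface at its own step. Then $J^{(L)}$ has leading singularities, and its leading singularities are exactly the two numbers $$\pm\frac{1}{(4\pi^2)^{L}}\cdot\frac{1}{(p_3^2)^L\sqrt{\lambda_K\big(1,\tfrac{p_1^2}{p_3^2},\tfrac{p_2^2}{p_3^2}\big)}}.$$ That is, up to sign and up to a numerical factor depending only on $L$, the leading singularity equals $1/\big((p_3^2)^L\sqrt{\lambda_K(1,p_1^2/p_3^2,p_2^2/p_3^2)}\big)$. -/

import Mathlib

open MvPolynomial

noncomputable section

/-- The Minkowski square `q² = (q⁰)² - (q¹)² - (q²)² - (q³)²` of a four-vector. -/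
def minkowskiSq {R : Type*} [CommRing R] (q : Fin 4 → R) : R :=
  q 0 ^ 2 - q 1 ^ 2 - q 2 ^ 2 - q 3 ^ 2

/-- The Källén function. -/
def kallen (x y z : ℂ) : ℂ :=
  x ^ 2 + y ^ 2 + z ^ 2 - 2 * x * y - 2 * y * z - 2 * z * x

/-- The field `ℂ((t_{n-1})) ⋯ ((t_1))((t_0))` of iterated Laurent series. A series
`∑ c_γ t_0^{γ_0} ⋯ t_{n-1}^{γ_{n-1}}` is stored as a Hahn series with exponents in `ℤⁿ`, ordered
lexicographically: it is first a Laurent series in `t_0`, its coefficients are Laurent series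
in `t_1`, and so on. -/
abbrev IteratedLaurent (n : ℕ) : Type := HahnSeries (Lex (Fin n → ℤ)) ℂ

/-- The exponent of the monomial `t_k`. -/
def unitExponent {n : ℕ} (k : Fin n) : Lex (Fin n → ℤ) := toLex (Pi.single k 1)

/-- The derivation `t_k ∂/∂t_k`. For a function `f` one has
`df = ∑ k, (t_k ∂f/∂t_k) · dlog t_k`. -/
def eulerDeriv {n : ℕ} (k : Fin n) (f : IteratedLaurent n) : IteratedLaurent n where
  coeff γ := ((ofLex γ k : ℤ) : ℂ) * f.coeff γ
  isPWO_support' := f.isPWO_support.mono (by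
    intro γ hγ h0
    exact hγ (by simp [h0]))

/-- A complete flag of hypersurfaces for iterated residues in affine `n`-space with coordinates
`x_0, …, x_{n-1}`, given by local parameters `t_0, …, t_{n-1}`: the first hypersurface is
`t_0 = 0`, the second one is the hypersurface `t_1 = 0` of the first one, and so on. The flag may
live on a blow-up or on a compactification of affine space, so that poles of an iterated residue
that come from a Jacobian and poles at infinity are covered.

`coord` is the iterated Laurent expansion of the coordinates at the flag. `parameter` says that
the `t_k` are local parameters of the flag: up to a unit, each of them is the
expansion of a rational function of the coordinates (so, no ramified substitution such as
`t_0 = s²` is allowed). -/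
structure ResidueFlag (n : ℕ) where
  coord : Fin n → IteratedLaurent n
  parameter : ∀ k : Fin n, ∃ a b : MvPolynomial (Fin n) ℂ,
    aeval coord a ≠ 0 ∧ aeval coord b ≠ 0 ∧
      (aeval coord a).order - (aeval coord b).order = unitExponent k

/-- The coefficient `h` in the expansion
`(N / ∏ j, D_j) dx_0 ∧ ⋯ ∧ dx_{n-1} = h · dlog t_0 ∧ ⋯ ∧ dlog t_{n-1}`
at the flag. -/
def ResidueFlag.dlogCoeff {n : ℕ} {J : Type*} [Fintype J] (F : ResidueFlag n)
    (N : MvPolynomial (Fin n) ℂ) (D : J → MvPolynomial (Fin n) ℂ) : IteratedLaurent n :=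
  aeval F.coord N / (∏ j, aeval F.coord (D j)) *
    (Matrix.of fun i k : Fin n => eulerDeriv k (F.coord i)).det

/-- Every propagator is cut along the flag: distinct propagators are assigned to distinct steps,
and `D_j` is, up to a unit, the local parameter `t_k` of its step `k`. -/
def ResidueFlag.CutsAll {n : ℕ} {J : Type*} (F : ResidueFlag n)
    (D : J → MvPolynomial (Fin n) ℂ) : Prop :=
  ∃ σ : J ↪ Fin n, ∀ j, (aeval F.coord (D j)).order = unitExponent (σ j)

/-- `r` is a leading singularity of `∫ dx_0 ∧ ⋯ ∧ dx_{n-1} N / ∏ j, D_j`: an `n`-fold iterated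
residue over all polar sets. Along a flag on which all propagators are cut, the residues are taken
successively at `t_0 = 0`, `t_1 = 0`, …, `t_{n-1} = 0`, with a first-order pole at every step (the
lexicographic order of `h` is `0`); the number that remains after the last step is the coefficient
of `dlog t_0 ∧ ⋯ ∧ dlog t_{n-1}`. -/
def IsLeadingSingularity {n : ℕ} {J : Type*} [Fintype J]
    (N : MvPolynomial (Fin n) ℂ) (D : J → MvPolynomial (Fin n) ℂ) (r : ℂ) : Prop :=
  r ≠ 0 ∧ ∃ F : ResidueFlag n, F.CutsAll D ∧
    (F.dlogCoeff N D).order = 0 ∧ (F.dlogCoeff N D).coeff 0 = r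

/-- The loop momenta `ℓ_1, …, ℓ_L` as vectors of coordinate functions on `ℂ^{4L}`, together with
`ℓ_0 = 0`. (The value for indices above `L` is not used.) -/
def loopMomentum (L : ℕ) : ℕ → Fin 4 → MvPolynomial (Fin (L * 4)) ℂ
  | 0 => 0
  | i + 1 => fun μ => if h : i < L then X (finProdFinEquiv (⟨i, h⟩, μ)) else 0

/-- The `3L` massless propagators `(ℓ_i - p₁)²`, `(ℓ_i + p₂)²`, `(ℓ_{i-1} - ℓ_i)²`,
`1 ≤ i ≤ L`, of the planar ladder triangle. -/
def ladderPropagator (L : ℕ) (p₁ p₂ : Fin 4 → ℂ) (j : Fin L × Fin 3) :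
    MvPolynomial (Fin (L * 4)) ℂ :=
  ![minkowskiSq (fun μ => loopMomentum L (j.1 + 1) μ - C (p₁ μ)),
    minkowskiSq (fun μ => loopMomentum L (j.1 + 1) μ + C (p₂ μ)),
    minkowskiSq (fun μ => loopMomentum L j.1 μ - loopMomentum L (j.1 + 1) μ)] j.2

/-- The normalisation of the measure `∏ i, d⁴ℓ_i / (i π²)`. -/
def loopMeasure (L : ℕ) : MvPolynomial (Fin (L * 4)) ℂ :=
  C ((1 / (Complex.I * (Real.pi : ℂ) ^ 2)) ^ L)

end

/-!
Fix the loop momentum `k` of the previous loop (`k = 0` for the first loop). Relative to `p₁`, and in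
linear coordinates in which a four-vector is a `2 × 2` matrix, the Minkowski square is `s = p₃²`
times the determinant and `p₃` is the identity matrix (`exists_isFrame`). With `m = ℓ - p₁` and `k`
shifted likewise, the three propagators of the loop are `s det m`, `s det (m - 1)` and
`s det (m - k)`. In an eigenbasis of `k`, with eigenvalues `a ≠ b`, their differences fix the diagonal of
`m`, and then `det m` fixes the product of the off-diagonal entries. A single free variable is left,
an off-diagonal entry, the function `lightCone`. Its Jacobian together with the propagators is
`(a - b) · lightCone` (`det_cutJacobian`), so the integrand of the loop is
`± (4π² s)⁻¹ (a - b)⁻¹` times the wedge product of the logarithmic differentials of the three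
propagators and of the light-cone coordinate. The eigenvectors depend on the previous momenta only,
hence these transformations are block triangular over all loops, and `dlogCoeff_eq` writes the whole
integrand as `∏ (± (4π² s)⁻¹ (a - b)⁻¹)` times one determinant of logarithmic derivatives.

At the last point of a flag on which the propagators are cut, the logarithmic derivatives of a series
become the exponents of its leading monomial (`hasLimit_dlog`). A matrix with
`det k = det (k - 1) = 0` has the eigenvalues `0` and `1`, so each loop after the first contributes
`a - b = -1`, while for the first loop `(a - b)²` is the Källén function of the external momenta.
What remains is the determinant of the integral matrix of exponents of the propagators and light-cone
coordinates, and this determinant is `± 1` if it is not zero. The reason is that `s⁻¹` times the first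
two propagators of a loop are `a b` and `(1 - a)(1 - b)` for the eigenvalues `a → 0` and `b → 1` of
`m`, so that all coordinates lie in the field generated by the independent series `a`, `1 - b`,
`det (m - k)` and `lightCone` of all loops (`momentum_mem`). Its value group is generated by the
exponents of these generators (`order_mem_of_mem_adjoin`), and it contains those of the local
parameters, hence is all of `ℤⁿ`.

Conversely, the cut equations can be solved for `m`, with the propagators and the off-diagonal entry
prescribed (`solveCut`). Taking independent parameters for them yields a flag with unimodular exponents
(`exists_flag`); interchanging the two eigenvalues of `-p₁` changes the sign of the residue.
-/

noncomputable section

/-! ### Logarithmic derivatives and limits of iterated Laurent series -/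

/-- The logarithmic derivations `t_k ∂/∂t_k` assembled into one derivation, the exterior derivative
in the basis `dlog t_0, …, dlog t_{n-1}`. -/
def logGradient (n : ℕ) : Derivation ℂ (IteratedLaurent n) (Fin n → IteratedLaurent n) :=
  Derivation.mk'
    { toFun := fun f k => eulerDeriv k f
      map_add' := fun f g => by
        ext k γ
        simp [eulerDeriv, mul_add]
      map_smul' := fun c f => by
        ext k γ
        simp [eulerDeriv, mul_left_comm] }
    (fun f g => by
      ext k γ
      have hf : (eulerDeriv k f).support ⊆ f.support := by
        intro δ hδ h0
        exact hδ (by simp [eulerDeriv, h0])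
      have hg : (eulerDeriv k g).support ⊆ g.support := by
        intro δ hδ h0
        exact hδ (by simp [eulerDeriv, h0])
      have e1 : ((f • fun k => eulerDeriv k g) + g • fun k => eulerDeriv k f) k
          = f * eulerDeriv k g + eulerDeriv k f * g := by
        simp [mul_comm]
      change (eulerDeriv k (f * g)).coeff γ = (((f • fun k => eulerDeriv k g) +
        g • fun k => eulerDeriv k f) k).coeff γ
      rw [e1, HahnSeries.coeff_add, HahnSeries.coeff_mul_right' g.isPWO_support hg,
        HahnSeries.coeff_mul_left' f.isPWO_support hf, ← Finset.sum_add_distrib]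
      change _ * (f * g).coeff γ = _
      rw [HahnSeries.coeff_mul, Finset.mul_sum]
      refine Finset.sum_congr rfl fun ij hij => ?_
      have h := (Finset.mem_antidiagonal.mp hij).2.2
      have h' : (ofLex γ k : ℤ) = ofLex ij.1 k + ofLex ij.2 k := by
        rw [← h]; rfl
      rw [h']
      simp only [eulerDeriv]
      push_cast
      ring)

/-- `f` is regular along the flag `t_0 = 0, t_1 = 0, …`, with value `c` at its last point. -/
def HasLimit {n : ℕ} (f : IteratedLaurent n) (c : ℂ) : Prop :=
  0 < (f - HahnSeries.C c).orderTop

namespace HasLimit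

variable {n : ℕ} {f g : IteratedLaurent n} {c d : ℂ}

theorem const (c : ℂ) : HasLimit (HahnSeries.C c : IteratedLaurent n) c := by
  simp [HasLimit]

theorem algebraMap_const (c : ℂ) : HasLimit (algebraMap ℂ (IteratedLaurent n) c) c :=
  const c

theorem one : HasLimit (1 : IteratedLaurent n) 1 := by
  simpa using const (n := n) 1

theorem zero : HasLimit (0 : IteratedLaurent n) 0 := by
  simpa using const (n := n) 0

theorem add (hf : HasLimit f c) (hg : HasLimit g d) : HasLimit (f + g) (c + d) := by
  have : f + g - HahnSeries.C (c + d) = (f - HahnSeries.C c) + (g - HahnSeries.C d) := by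
    rw [map_add]; ring
  rw [HasLimit, this]
  exact lt_of_lt_of_le (lt_min hf hg) HahnSeries.min_orderTop_le_orderTop_add

theorem neg (hf : HasLimit f c) : HasLimit (-f) (-c) := by
  have : -f - HahnSeries.C (-c) = -(f - HahnSeries.C c) := by
    rw [map_neg]; ring
  rw [HasLimit, this, HahnSeries.orderTop_neg]
  exact hf

theorem sub (hf : HasLimit f c) (hg : HasLimit g d) : HasLimit (f - g) (c - d) := by
  simpa [sub_eq_add_neg] using hf.add hg.neg

theorem orderTop_C_nonneg (c : ℂ) : 0 ≤ (HahnSeries.C c : IteratedLaurent n).orderTop := by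
  exact HahnSeries.orderTop_single_le

theorem orderTop_nonneg (hf : HasLimit f c) : 0 ≤ f.orderTop := by
  have : f = (f - HahnSeries.C c) + HahnSeries.C c := by ring
  rw [this]
  exact le_trans (le_min (le_of_lt hf) (orderTop_C_nonneg c))
    HahnSeries.min_orderTop_le_orderTop_add

theorem mul (hf : HasLimit f c) (hg : HasLimit g d) : HasLimit (f * g) (c * d) := by
  have : f * g - HahnSeries.C (c * d) =
      (f - HahnSeries.C c) * g + HahnSeries.C c * (g - HahnSeries.C d) := by
    rw [map_mul]; ring
  rw [HasLimit, this]
  refine lt_of_lt_of_le (lt_min ?_ ?_) HahnSeries.min_orderTop_le_orderTop_add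
  · rw [HahnSeries.orderTop_mul]
    exact add_pos_of_pos_of_nonneg hf hg.orderTop_nonneg
  · rw [HahnSeries.orderTop_mul]
    rw [add_comm]
    exact add_pos_of_pos_of_nonneg hg (orderTop_C_nonneg c)

theorem prod {ι : Type*} (s : Finset ι) {f : ι → IteratedLaurent n} {c : ι → ℂ}
    (h : ∀ i ∈ s, HasLimit (f i) (c i)) : HasLimit (∏ i ∈ s, f i) (∏ i ∈ s, c i) := by
  classical
  induction s using Finset.induction_on with
  | empty => simpa using one
  | insert a s ha ih =>
    rw [Finset.prod_insert ha, Finset.prod_insert ha]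
    exact (h a (by simp)).mul (ih fun i hi => h i (by simp [hi]))

theorem sum {ι : Type*} (s : Finset ι) {f : ι → IteratedLaurent n} {c : ι → ℂ}
    (h : ∀ i ∈ s, HasLimit (f i) (c i)) : HasLimit (∑ i ∈ s, f i) (∑ i ∈ s, c i) := by
  classical
  induction s using Finset.induction_on with
  | empty => simpa using zero
  | insert a s ha ih =>
    rw [Finset.sum_insert ha, Finset.sum_insert ha]
    exact (h a (by simp)).add (ih fun i hi => h i (by simp [hi]))

theorem det {ι : Type*} [Fintype ι] [DecidableEq ι] {A : Matrix ι ι (IteratedLaurent n)}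
    {B : Matrix ι ι ℂ} (h : ∀ i j, HasLimit (A i j) (B i j)) : HasLimit A.det B.det := by
  rw [Matrix.det_apply, Matrix.det_apply]
  refine sum _ fun σ _ => ?_
  have := prod (f := fun i => A (σ i) i) (c := fun i => B (σ i) i) Finset.univ
    fun i _ => h (σ i) i
  rcases Int.units_eq_one_or (Equiv.Perm.sign σ) with hs | hs
  · simpa [hs] using this
  · simpa [hs] using this.neg

theorem coeff_zero (hf : HasLimit f c) : f.coeff 0 = c := by
  have := HahnSeries.coeff_eq_zero_of_lt_orderTop (x := f - HahnSeries.C c) (i := 0) hf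
  simpa [sub_eq_zero] using this

theorem ne_zero (hf : HasLimit f c) (hc : c ≠ 0) : f ≠ 0 := by
  rintro rfl
  exact hc (by simpa using hf.coeff_zero.symm)

theorem order_eq_zero (hf : HasLimit f c) (hc : c ≠ 0) : f.order = 0 := by
  refine le_antisymm ?_ ?_
  · exact HahnSeries.order_le_of_coeff_ne_zero (by rwa [hf.coeff_zero])
  · exact HahnSeries.zero_le_orderTop_iff.mp hf.orderTop_nonneg

theorem inv (hf : HasLimit f c) (hc : c ≠ 0) : HasLimit f⁻¹ c⁻¹ := by
  have hf0 := hf.ne_zero hc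
  have hC : (HahnSeries.C c : IteratedLaurent n) ≠ 0 := by simpa using hc
  have e : (f⁻¹ - HahnSeries.C c⁻¹) * f * HahnSeries.C c = -(f - HahnSeries.C c) := by
    rw [map_inv₀]; field_simp; ring
  have e2 := congrArg HahnSeries.orderTop e
  rw [HahnSeries.orderTop_neg, HahnSeries.orderTop_mul, HahnSeries.orderTop_mul,
    ← HahnSeries.order_eq_orderTop_of_ne_zero hf0, ← HahnSeries.order_eq_orderTop_of_ne_zero hC,
    hf.order_eq_zero hc, HahnSeries.order_C] at e2
  rw [HasLimit]
  have h3 : 0 < (f - HahnSeries.C c).orderTop := hf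
  rw [← e2] at h3
  simpa using h3

theorem div (hf : HasLimit f c) (hg : HasLimit g d) (hd : d ≠ 0) : HasLimit (f / g) (c / d) := by
  simpa [div_eq_mul_inv] using hf.mul (hg.inv hd)

theorem pow (hf : HasLimit f c) (m : ℕ) : HasLimit (f ^ m) (c ^ m) := by
  simpa using prod (f := fun _ => f) (c := fun _ => c) (Finset.range m) fun _ _ => hf

end HasLimit

theorem hasLimit_zero_of_order_pos {n : ℕ} {f : IteratedLaurent n} (h : 0 < f.order) :
    HasLimit f 0 := by
  simpa [HasLimit] using HahnSeries.zero_lt_orderTop_of_order h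

theorem order_div {n : ℕ} {f g : IteratedLaurent n} (hf : f ≠ 0) (hg : g ≠ 0) :
    (f / g).order = f.order - g.order := by
  have h := HahnSeries.order_mul (div_ne_zero hf hg) hg
  rw [div_mul_cancel₀ f hg] at h
  rw [h]; abel

theorem order_inv {n : ℕ} {f : IteratedLaurent n} (hf : f ≠ 0) : f⁻¹.order = -f.order := by
  have := order_div one_ne_zero hf
  simpa using this

/-- The logarithmic derivative of `f` along `t_k` is regular, and its value is the `k`-th exponent
of the leading monomial of `f`. -/
theorem hasLimit_dlog {n : ℕ} {f : IteratedLaurent n} (hf : f ≠ 0) (k : Fin n) :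
    HasLimit (eulerDeriv k f / f) ((ofLex f.order k : ℤ) : ℂ) := by
  set c : ℂ := ((ofLex f.order k : ℤ) : ℂ) with hc
  have hlt : f.orderTop < (eulerDeriv k f - HahnSeries.C c * f).orderTop := by
    rw [← HahnSeries.order_eq_orderTop_of_ne_zero hf]
    have hco : ∀ γ : Lex (Fin n → ℤ), (eulerDeriv k f - HahnSeries.C c * f).coeff γ
        = (((ofLex γ k : ℤ) : ℂ) - c) * f.coeff γ := by
      intro γ
      rw [HahnSeries.coeff_sub, HahnSeries.C_mul_eq_smul, HahnSeries.coeff_smul, smul_eq_mul]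
      simp only [eulerDeriv]
      ring
    refine lt_of_le_of_ne ?_ ?_
    · rw [HahnSeries.le_orderTop_iff_forall]
      intro γ hγ
      rw [hco, HahnSeries.coeff_eq_zero_of_lt_order (WithTop.coe_lt_coe.mp hγ), mul_zero]
    · exact (HahnSeries.orderTop_ne_of_coeff_eq_zero (by rw [hco, hc, sub_self, zero_mul])).symm
  have e : (eulerDeriv k f / f - HahnSeries.C c) * f = eulerDeriv k f - HahnSeries.C c * f := by
    field_simp
  rw [← e, HahnSeries.orderTop_mul, ← HahnSeries.order_eq_orderTop_of_ne_zero hf] at hlt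
  rw [HasLimit]
  by_contra hcon
  rw [not_lt] at hcon
  have := add_le_add_left hcon ((f.order : Lex (Fin n → ℤ)) : WithTop (Lex (Fin n → ℤ)))
  rw [zero_add] at this
  exact absurd hlt (not_lt.mpr this)

theorem unitExponent_pos {n : ℕ} (k : Fin n) : 0 < unitExponent k := by
  rw [unitExponent, ← toLex_zero]
  exact Pi.toLex_strictMono (Pi.single_pos.mpr one_pos)

theorem hasLimit_of_coeff_zero {n : ℕ} {f : IteratedLaurent n} {c : ℂ} (h : 0 ≤ f.orderTop)
    (hc : f.coeff 0 = c) : HasLimit f c := by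
  refine lt_of_le_of_ne ?_ ?_
  · rw [sub_eq_add_neg]
    refine le_trans (le_min h ?_) HahnSeries.min_orderTop_le_orderTop_add
    rw [HahnSeries.orderTop_neg]
    exact HasLimit.orderTop_C_nonneg c
  · exact (HahnSeries.orderTop_ne_of_coeff_eq_zero (by simp [hc])).symm

/-- A series with constant term `1` has a square root with constant term `1`, given by the
binomial series. -/
theorem HasLimit.exists_sqrt {n : ℕ} {f : IteratedLaurent n} (hf : HasLimit f 1) :
    ∃ w : IteratedLaurent n, w ^ 2 = f ∧ HasLimit w 1 := by
  have hx : 0 < (f - 1).orderTop := by simpa [HasLimit] using hf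
  set S : PowerSeries ℂ := PowerSeries.binomialSeries ℂ (1 / 2 : ℚ) with hS
  have hS2 : S ^ 2 = 1 + PowerSeries.X := by
    have h := PowerSeries.binomialSeries_nat (R := ℚ) (A := ℂ) 1
    rw [sq, hS, ← PowerSeries.binomialSeries_add]
    norm_num
    simpa using h
  have hX : PowerSeries.heval (f - 1) (PowerSeries.X : PowerSeries ℂ) = f - 1 := by
    exact PowerSeries.heval_X _ hx
  have hw : PowerSeries.heval (f - 1) S ^ 2 = f := by
    rw [← map_pow, hS2, map_add, map_one, hX]; ring
  refine ⟨_, hw, hasLimit_of_coeff_zero ?_ ?_⟩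
  · rw [HahnSeries.zero_le_orderTop_iff]
    have h := HahnSeries.order_pow (PowerSeries.heval (f - 1) S) 2
    rw [hw, hf.order_eq_zero one_ne_zero] at h
    have := (smul_eq_zero.mp h.symm).resolve_left two_ne_zero
    exact this.ge
  · rw [PowerSeries.coeff_heval_zero, hS, PowerSeries.binomialSeries_constantCoeff]

/-- Terms of pairwise distinct orders do not cancel. -/
theorem exists_orderTop_sum_eq {n : ℕ} {ι : Type*} (s : Finset ι) (f : ι → IteratedLaurent n)
    (hf : ∀ i ∈ s, f i ≠ 0) (hinj : Set.InjOn (fun i => (f i).order) s) (hs : s.Nonempty) :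
    ∃ i ∈ s, (∑ j ∈ s, f j).orderTop = (f i).orderTop := by
  classical
  induction hs using Finset.Nonempty.cons_induction with
  | singleton a => exact ⟨a, by simp, by simp⟩
  | cons a s ha hs ih =>
    obtain ⟨i, hi, h⟩ := ih (fun i hi => hf i (by simp [hi]))
      (hinj.mono (by simp))
    rw [Finset.sum_cons]
    have hne : (f a).orderTop ≠ (∑ j ∈ s, f j).orderTop := by
      rw [h, ← HahnSeries.order_eq_orderTop_of_ne_zero (hf a (by simp)),
        ← HahnSeries.order_eq_orderTop_of_ne_zero (hf i (by simp [hi]))]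
      intro h'
      have := hinj (by simp) (by simp [hi]) (WithTop.coe_injective h')
      exact ha (this ▸ hi)
    rcases lt_or_gt_of_ne hne with hlt | hlt
    · exact ⟨a, by simp, HahnSeries.orderTop_add_eq_left hlt⟩
    · exact ⟨i, by simp [hi], by rw [HahnSeries.orderTop_add_eq_right hlt, h]⟩

/-- If the leading exponents of `f_1, …, f_m` are independent, distinct monomials in the `f_j` have
distinct orders, so no cancellation of leading terms is possible in a polynomial in the `f_j`. Hence
the value group of the field `ℂ(f_1, …, f_m)` is generated by the orders of the `f_j`. -/
theorem order_mem_of_mem_adjoin {n : ℕ} {ι : Type*} [Fintype ι] (f : ι → IteratedLaurent n)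
    (hf : ∀ i, f i ≠ 0) (hli : LinearIndependent ℤ fun i => (f i).order)
    {x : IteratedLaurent n} (hx : x ∈ IntermediateField.adjoin ℂ (Set.range f)) :
    x.order ∈ Submodule.span ℤ (Set.range fun i => (f i).order) := by
  have key : ∀ P : MvPolynomial ι ℂ, (aeval f P).order ∈
      Submodule.span ℤ (Set.range fun i => (f i).order) := by
    intro P
    have hterm : ∀ m : ι →₀ ℕ, (∏ i, f i ^ m i) ≠ 0 := fun m =>
      Finset.prod_ne_zero_iff.mpr fun i _ => pow_ne_zero _ (hf i)
    have hprod : ∀ (s : Finset ι) (m : ι →₀ ℕ), (∏ i ∈ s, f i ^ m i).order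
        = ∑ i ∈ s, (m i : ℤ) • (f i).order := by
      classical
      intro s m
      induction s using Finset.induction_on with
      | empty => simp
      | insert a s ha ih =>
        rw [Finset.prod_insert ha, Finset.sum_insert ha, HahnSeries.order_mul
          (pow_ne_zero _ (hf a)) (Finset.prod_ne_zero_iff.mpr fun i _ => pow_ne_zero _ (hf i)),
          ih, HahnSeries.order_pow, natCast_zsmul]
    have hord : ∀ m ∈ P.support, (P.coeff m • ∏ i, f i ^ m i).order
        = ∑ i, (m i : ℤ) • (f i).order := by
      intro m hm
      rw [← HahnSeries.C_mul_eq_smul, HahnSeries.order_mul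
        (by simpa using hm) (hterm m), HahnSeries.order_C, zero_add, hprod]
    have hP : aeval f P = ∑ m ∈ P.support, P.coeff m • ∏ i, f i ^ m i := by
      rw [aeval_def, eval₂_eq']
      exact Finset.sum_congr rfl fun m _ => (Algebra.smul_def _ _).symm
    rcases P.support.eq_empty_or_nonempty with h0 | h0
    · rw [hP, h0, Finset.sum_empty, HahnSeries.order_zero]
      exact Submodule.zero_mem _
    · have hne : ∀ m ∈ P.support, P.coeff m • ∏ i, f i ^ m i ≠ 0 := fun m hm =>
        smul_ne_zero (by simpa using hm) (hterm m)
      obtain ⟨m, hm, h⟩ := exists_orderTop_sum_eq P.support (fun m => P.coeff m • ∏ i, f i ^ m i) hne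
        (by
          intro m hm m' hm' h
          simp only at h
          rw [hord m hm, hord m' hm'] at h
          have h2 := Fintype.linearIndependent_iff.mp hli (fun i => (m i : ℤ) - m' i) (by
            simp only [sub_smul, Finset.sum_sub_distrib, h, sub_self])
          ext i
          have := h2 i
          omega) h0
      rw [← hP, ← HahnSeries.order_eq_orderTop_of_ne_zero (hne m hm)] at h
      have hP0 : aeval f P ≠ 0 := by
        intro h'
        rw [h', HahnSeries.orderTop_zero] at h
        exact WithTop.top_ne_coe h
      rw [← HahnSeries.order_eq_orderTop_of_ne_zero hP0] at h
      rw [WithTop.coe_injective h, hord m hm]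
      exact Submodule.sum_mem _ fun i _ =>
        Submodule.smul_mem _ _ (Submodule.subset_span ⟨i, rfl⟩)
  obtain ⟨p, q, rfl⟩ := (IntermediateField.mem_adjoin_range_iff ℂ f x).mp hx
  by_cases hp : aeval f p = 0
  · simp [hp]
  by_cases hq : aeval f q = 0
  · simp [hq]
  rw [order_div hp hq]
  exact Submodule.sub_mem _ (key p) (key q)

/-! ### The cut equations of one loop -/

section SplitForm

variable {K : Type*}

/-- The determinant of the matrix `!![w 0, w 1; w 2, w 3]`, a split quadratic form in four
variables. -/
def splitForm [CommRing K] (w : Fin 4 → K) : K := w 0 * w 3 - w 1 * w 2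

/-- The identity matrix, as a vector of length four. -/
def unitVec [CommRing K] : Fin 4 → K := ![1, 0, 0, 1]

/-- `a` and `b` are the eigenvalues of the matrix `!![k 0, k 1; k 2, k 3]`. -/
def IsEigenpair [CommRing K] (k : Fin 4 → K) (a b : K) : Prop :=
  a + b = k 0 + k 3 ∧ a * b = splitForm k

/-- The matrix entry `ψ m φ`, where `φ` is the eigenvector of the matrix `k` to the eigenvalue `b`,
and the row vector `ψ` is orthogonal to it, hence an eigenvector to the other eigenvalue. It is one
of the two off-diagonal entries of `m` in an eigenbasis of `k`, up to normalisation. That is, it is a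
light-cone coordinate of `m` in the plane orthogonal to `k` and the identity. -/
def lightCone [CommRing K] (k : Fin 4 → K) (b : K) (m : Fin 4 → K) : K :=
  m 1 * (b - k 0) ^ 2 + (m 0 - m 3) * k 1 * (b - k 0) - m 2 * k 1 ^ 2

/-- The four functions of a loop momentum `m` (with neighbour `k`) whose logarithmic differentials
make up the integrand of the loop: the three propagators and a light-cone coordinate. -/
def cutFun [CommRing K] (k : Fin 4 → K) (b : K) (m : Fin 4 → K) : Fin 4 → K :=
  ![splitForm m, splitForm (m - unitVec), splitForm (m - k), lightCone k b m]

/-- The Jacobian matrix of `cutFun k b` with respect to `m`. -/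
def cutJacobian [CommRing K] (k : Fin 4 → K) (b : K) (m : Fin 4 → K) : Matrix (Fin 4) (Fin 4) K :=
  !![m 3, -m 2, -m 1, m 0;
     m 3 - 1, -m 2, -m 1, m 0 - 1;
     m 3 - k 3, -(m 2 - k 2), -(m 1 - k 1), m 0 - k 0;
     k 1 * (b - k 0), (b - k 0) ^ 2, -k 1 ^ 2, -(k 1 * (b - k 0))]

theorem det_cutJacobian [CommRing K] {k : Fin 4 → K} {a b : K} (h : IsEigenpair k a b)
    (m : Fin 4 → K) : (cutJacobian k b m).det = (a - b) * lightCone k b m := by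
  obtain ⟨h1, h2⟩ := h
  have ha : a = k 0 + k 3 - b := by linear_combination h1
  subst ha
  have h2' : k 1 * k 2 = k 0 * k 3 - (k 0 + k 3 - b) * b := by
    rw [splitForm] at h2; linear_combination h2
  simp [cutJacobian, lightCone, Matrix.det_succ_row_zero, Fin.sum_univ_succ, Fin.succAbove]
  linear_combination (-(2 * m 1 * (b - k 0) + k 1 * (m 0 - m 3))) * h2'

theorem derivation_cutFun_sub_mem [Field K] [Algebra ℂ K] {V : Type*} [AddCommGroup V] [Module K V]
    [Module ℂ V]
    (d : Derivation ℂ K V) (W : Submodule K V) {k : Fin 4 → K} {b : K} (m : Fin 4 → K)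
    (hk : ∀ μ, d (k μ) ∈ W) (hb : d b ∈ W) (j : Fin 4) :
    d (cutFun k b m j) - ∑ μ, cutJacobian k b m j μ • d (m μ) ∈ W := by
  have hs : ∀ w : Fin 4 → K, d (splitForm w)
      = w 0 • d (w 3) + w 3 • d (w 0) - (w 1 • d (w 2) + w 2 • d (w 1)) := by
    intro w; simp [splitForm]
  have u0 : (unitVec : Fin 4 → K) 0 = 1 := rfl
  have u1 : (unitVec : Fin 4 → K) 1 = 0 := rfl
  have u2 : (unitVec : Fin 4 → K) 2 = 0 := rfl
  have u3 : (unitVec : Fin 4 → K) 3 = 1 := rfl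
  fin_cases j
  · have : d (cutFun k b m 0) - ∑ μ, cutJacobian k b m 0 μ • d (m μ) = 0 := by
      simp [cutFun, cutJacobian, Fin.sum_univ_four, hs]
      module
    simp [this]
  · have : d (cutFun k b m 1) - ∑ μ, cutJacobian k b m 1 μ • d (m μ) = 0 := by
      simp [cutFun, cutJacobian, Fin.sum_univ_four, hs, u0, u1, u2, u3]
      module
    simp [this]
  · have : d (cutFun k b m 2) - ∑ μ, cutJacobian k b m 2 μ • d (m μ) =
        -((m 0 - k 0) • d (k 3)) - (m 3 - k 3) • d (k 0) + (m 1 - k 1) • d (k 2)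
          + (m 2 - k 2) • d (k 1) := by
      simp [cutFun, cutJacobian, Fin.sum_univ_four, hs]
      module
    simp only [Fin.reduceFinMk, this]
    exact W.add_mem (W.add_mem (W.sub_mem (W.neg_mem (W.smul_mem _ (hk _))) (W.smul_mem _ (hk _)))
      (W.smul_mem _ (hk _))) (W.smul_mem _ (hk _))
  · have : d (cutFun k b m 3) - ∑ μ, cutJacobian k b m 3 μ • d (m μ) =
        (2 * m 1 * (b - k 0) + (m 0 - m 3) * k 1) • (d b - d (k 0))
          + ((m 0 - m 3) * (b - k 0) - 2 * m 2 * k 1) • d (k 1) := by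
      simp [cutFun, cutJacobian, Fin.sum_univ_four, lightCone, pow_two]
      module
    simp only [Fin.reduceFinMk, this]
    exact W.add_mem (W.smul_mem _ (W.sub_mem hb (hk _))) (W.smul_mem _ (hk _))

/-- The eigenvalues of a matrix are algebraic over its entries. -/
theorem IsEigenpair.derivation_mem [Field K] [Algebra ℂ K] {V : Type*} [AddCommGroup V]
    [Module K V] [Module ℂ V]
    (d : Derivation ℂ K V) (W : Submodule K V) {k : Fin 4 → K} {a b : K} (h : IsEigenpair k a b)
    (hab : a ≠ b) (hk : ∀ μ, d (k μ) ∈ W) : d b ∈ W := by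
  obtain ⟨h1, h2⟩ := h
  have e1 : d a + d b = d (k 0) + d (k 3) := by rw [← map_add, h1, map_add]
  have e2 : a • d b + b • d a =
      k 0 • d (k 3) + k 3 • d (k 0) - (k 1 • d (k 2) + k 2 • d (k 1)) := by
    have := congrArg d h2
    simpa [splitForm] using this
  have e3 : (a - b) • d b = (k 0 • d (k 3) + k 3 • d (k 0) - (k 1 • d (k 2) + k 2 • d (k 1)))
      - b • (d (k 0) + d (k 3)) := by
    rw [← e1, ← e2]; module
  have e4 : d b = (a - b)⁻¹ • ((a - b) • d b) := by
    rw [smul_smul, inv_mul_cancel₀ (sub_ne_zero.mpr hab), one_smul]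
  rw [e4, e3]
  exact W.smul_mem _ (W.sub_mem (W.sub_mem (W.add_mem (W.smul_mem _ (hk _)) (W.smul_mem _ (hk _)))
    (W.add_mem (W.smul_mem _ (hk _)) (W.smul_mem _ (hk _))))
    (W.smul_mem _ (W.add_mem (hk _) (hk _))))

variable [Field K]

/-- The matrix with entries `!![A, B; C, D]` in the eigenbasis `(k 1, a - k 0)`, `(k 1, b - k 0)`
of the matrix `k`. -/
def ofEigenbasis (k : Fin 4 → K) (a b A B C D : K) : Fin 4 → K :=
  ![((b - k 0) * (A + C) - (a - k 0) * (B + D)) / (b - a),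
    k 1 * ((B + D) - (A + C)) / (b - a),
    ((b - k 0) * ((a - k 0) * A + (b - k 0) * C) - (a - k 0) * ((a - k 0) * B + (b - k 0) * D))
      / (k 1 * (b - a)),
    (((a - k 0) * B + (b - k 0) * D) - ((a - k 0) * A + (b - k 0) * C)) / (b - a)]

/-- The first diagonal entry, in an eigenbasis of `k`, of a matrix on which the three propagators
take the values `y`, `z`, `x`. -/
def diagFst (a b y z x : K) : K := ((y - x + a * b) - a * (y - z + 1)) / (b - a)

/-- The second diagonal entry, in an eigenbasis of `k`, of a matrix on which the three propagators
take the values `y`, `z`, `x`. -/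
def diagSnd (a b y z x : K) : K := (b * (y - z + 1) - (y - x + a * b)) / (b - a)

/-- The matrix on which the three propagators take the values `y`, `z`, `x`, and which has the upper
off-diagonal entry `B` in the eigenbasis of `k`. -/
def solveCut (k : Fin 4 → K) (a b y z x B : K) : Fin 4 → K :=
  ofEigenbasis k a b (diagFst a b y z x) B ((diagFst a b y z x * diagSnd a b y z x - y) / B)
    (diagSnd a b y z x)

/-- `solveCut` solves the cut equations. -/
theorem cutFun_solveCut {k : Fin 4 → K} {a b : K} (h : IsEigenpair k a b) (hab : a ≠ b)
    (hk : k 1 ≠ 0) {B : K} (hB : B ≠ 0) (y z x : K) :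
    cutFun k b (solveCut k a b y z x B) = ![y, z, x, (b - a) * k 1 * B] := by
  have hab' : b - a ≠ 0 := sub_ne_zero.mpr hab.symm
  obtain ⟨h1, h2⟩ := h
  have h3 : k 3 = a + b - k 0 := by linear_combination -h1
  have h2' : k 2 = (k 0 * (a + b - k 0) - a * b) / k 1 := by
    rw [splitForm, h3] at h2; field_simp; linear_combination h2
  have hs : ∀ A B C D, splitForm (ofEigenbasis k a b A B C D) = A * D - B * C := by
    intro A B C D
    simp only [splitForm, ofEigenbasis, Matrix.cons_val]
    field_simp
    ring
  have hz : ∀ A B C D, splitForm (ofEigenbasis k a b A B C D - unitVec)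
      = A * D - B * C - (A + D) + 1 := by
    intro A B C D
    simp only [splitForm, ofEigenbasis, unitVec, Matrix.cons_val, Pi.sub_apply]
    field_simp
    ring
  have hx : ∀ A B C D, splitForm (ofEigenbasis k a b A B C D - k)
      = A * D - B * C - (b * A + a * D) + a * b := by
    intro A B C D
    simp only [splitForm, ofEigenbasis, Matrix.cons_val, Pi.sub_apply]
    rw [h3, h2']
    field_simp
    ring
  have hu : ∀ A B C D, lightCone k b (ofEigenbasis k a b A B C D)
      = (b - a) * k 1 * B := by
    intro A B C D
    simp only [lightCone, ofEigenbasis, Matrix.cons_val]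
    field_simp
    ring
  have hBC : B * ((diagFst a b y z x * diagSnd a b y z x - y) / B)
      = diagFst a b y z x * diagSnd a b y z x - y := by field_simp
  rw [cutFun, solveCut, hs, hz, hx, hu, hBC]
  congr 1
  · ring
  congr 1
  · rw [diagFst, diagSnd]; field_simp; ring
  congr 1
  · rw [diagFst, diagSnd]; field_simp; ring

/-- Every solution of the cut equations off the locus `lightCone = 0` is of the form `solveCut`, so
it is a rational function of the cut functions. -/
theorem eq_solveCut {k : Fin 4 → K} {a b : K} (h : IsEigenpair k a b) (hab : a ≠ b)
    (hk : k 1 ≠ 0) {m : Fin 4 → K} (hu : lightCone k b m ≠ 0) :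
    m = solveCut k a b (splitForm m) (splitForm (m - unitVec)) (splitForm (m - k))
      (lightCone k b m / ((b - a) * k 1)) := by
  have hab' : b - a ≠ 0 := sub_ne_zero.mpr hab.symm
  obtain ⟨h1, h2⟩ := h
  have h3 : k 3 = a + b - k 0 := by linear_combination -h1
  have h2' : k 2 = (k 0 * (a + b - k 0) - a * b) / k 1 := by
    rw [splitForm, h3] at h2; field_simp; linear_combination h2
  set C : K := (-(a - k 0) * (m 0 * k 1 + m 1 * (a - k 0)) + k 1 * (m 2 * k 1 + m 3 * (a - k 0)))
    / ((b - a) * k 1) with hC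
  have hC' : (diagFst a b (splitForm m) (splitForm (m - unitVec)) (splitForm (m - k)) *
      diagSnd a b (splitForm m) (splitForm (m - unitVec)) (splitForm (m - k)) - splitForm m) /
      (lightCone k b m / ((b - a) * k 1)) = C := by
    rw [div_eq_iff (div_ne_zero hu (mul_ne_zero hab' hk)), hC]
    simp only [diagFst, diagSnd, splitForm, lightCone, unitVec, Matrix.cons_val, Pi.sub_apply]
    rw [h3, h2']
    field_simp
    ring
  rw [solveCut, hC', hC]
  ext i
  fin_cases i <;>
  · simp only [ofEigenbasis, diagFst, diagSnd, splitForm, lightCone, unitVec, Matrix.cons_val,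
      Pi.sub_apply, Fin.reduceFinMk, Fin.zero_eta, Fin.mk_one]
    rw [h3, h2']
    field_simp
    ring

end SplitForm

/-- If, modulo the span of the `g p` of earlier blocks, the vectors `f p` of every block arise from
the `g p` of the same block by the matrix `T i`, then the transition determinant is `∏ i, det T i`. -/
theorem det_eq_prod_det_mul {K : Type*} [Field K] {L m : ℕ}
    (f g : Fin L × Fin m → Fin L × Fin m → K) (T : Fin L → Matrix (Fin m) (Fin m) K)
    (h : ∀ i j, f (i, j) - ∑ μ, T i j μ • g (i, μ) ∈ Submodule.span K (g '' {p | p.1 < i})) :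
    (Matrix.of f).det = (∏ i, (T i).det) * (Matrix.of g).det := by
  classical
  have h' : ∀ p : Fin L × Fin m, ∃ c : Fin L × Fin m → K,
      ∑ q ∈ Finset.univ.filter (fun q => q.1 < p.1), c q • g q =
        f p - ∑ μ, T p.1 p.2 μ • g (p.1, μ) := by
    intro p
    apply (Submodule.mem_span_image_finset_iff_exists_fun' K).mp
    simpa using h p.1 p.2
  choose c hc using h'
  set A : Matrix (Fin L × Fin m) (Fin L × Fin m) K := Matrix.of fun p q =>
    if q.1 < p.1 then c p q else if q.1 = p.1 then T p.1 p.2 q.2 else 0 with hA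
  have hmul : Matrix.of f = A * Matrix.of g := by
    ext p k
    have e : f p = ∑ q, A p q • g q := by
      have e1 : f p = ∑ q ∈ Finset.univ.filter (fun q => q.1 < p.1), c p q • g q
          + ∑ μ, T p.1 p.2 μ • g (p.1, μ) := by rw [hc]; abel
      have e2 : ∀ q, A p q • g q = (if q.1 < p.1 then c p q • g q else 0)
          + (if q.1 = p.1 then T p.1 p.2 q.2 • g q else 0) := by
        intro q
        rcases lt_trichotomy q.1 p.1 with hq | hq | hq
        · simp [hA, hq, hq.ne]
        · simp [hA, hq]
        · simp [hA, hq.not_gt, hq.ne']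
      rw [e1, Finset.sum_congr rfl fun q _ => e2 q, Finset.sum_add_distrib, Finset.sum_filter]
      congr 1
      rw [Fintype.sum_prod_type]
      rw [Finset.sum_eq_single p.1]
      · simp
      · intro i _ hi; simp [hi]
      · simp
    rw [Matrix.mul_apply, Matrix.of_apply, e]
    simp
  have hAt : A.transpose.BlockTriangular Prod.fst := by
    intro p q hpq
    have hpq' : q.1 < p.1 := hpq
    simp [hA, hpq'.not_gt, hpq'.ne']
  rw [hmul, Matrix.det_mul, ← Matrix.det_transpose A, hAt.det_fintype]
  congr 1
  refine Finset.prod_congr rfl fun i _ => ?_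
  rw [← Matrix.det_transpose (T i)]
  let e : Fin m ≃ {p : Fin L × Fin m // p.1 = i} :=
    { toFun := fun j => ⟨(i, j), rfl⟩
      invFun := fun p => p.1.2
      left_inv := fun _ => rfl
      right_inv := by rintro ⟨⟨i', j⟩, rfl⟩; rfl }
  rw [← Matrix.det_submatrix_equiv_self e]
  congr 1
  ext j j'
  simp [Matrix.toSquareBlock, Matrix.toSquareBlockProp, e, hA]

/-! ### The integrand as a product of logarithmic differentials -/

/-- The image of a vector with entries in a `ℂ`-algebra under a complex matrix. -/
def frameMap (J : Matrix (Fin 4) (Fin 4) ℂ) {A : Type*} [CommRing A] [Algebra ℂ A]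
    (q : Fin 4 → A) : Fin 4 → A := fun ν => ∑ μ, algebraMap ℂ A (J ν μ) * q μ

theorem frameMap_sub (J : Matrix (Fin 4) (Fin 4) ℂ) {A : Type*} [CommRing A] [Algebra ℂ A]
    (q q' : Fin 4 → A) : frameMap J (q - q') = frameMap J q - frameMap J q' := by
  ext ν
  simp [frameMap, mul_sub]

theorem frameMap_algebraMap (J : Matrix (Fin 4) (Fin 4) ℂ) {A : Type*} [CommRing A] [Algebra ℂ A]
    (q : Fin 4 → ℂ) (ν : Fin 4) :
    frameMap J (fun μ => algebraMap ℂ A (q μ)) ν = algebraMap ℂ A (frameMap J q ν) := by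
  simp [frameMap]

theorem frameMap_mul (J J' : Matrix (Fin 4) (Fin 4) ℂ) {A : Type*} [CommRing A] [Algebra ℂ A]
    (q : Fin 4 → A) : frameMap (J * J') q = frameMap J (frameMap J' q) := by
  ext ν
  simp only [frameMap, Matrix.mul_apply, map_sum, map_mul, Finset.sum_mul, Finset.mul_sum]
  rw [Finset.sum_comm]
  exact Finset.sum_congr rfl fun _ _ => Finset.sum_congr rfl fun _ _ => by ring

theorem frameMap_one {A : Type*} [CommRing A] [Algebra ℂ A]
    (q : Fin 4 → A) : frameMap 1 q = q := by
  ext ν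
  simp [frameMap, Matrix.one_apply]

theorem frameMap_inv {J : Matrix (Fin 4) (Fin 4) ℂ} (hJ : J.det ≠ 0) {A : Type*} [CommRing A]
    [Algebra ℂ A] (q : Fin 4 → A) : frameMap J⁻¹ (frameMap J q) = q ∧
      frameMap J (frameMap J⁻¹ q) = q := by
  have hu : IsUnit J.det := isUnit_iff_ne_zero.mpr hJ
  rw [← frameMap_mul, ← frameMap_mul, Matrix.nonsing_inv_mul _ hu, Matrix.mul_nonsing_inv _ hu,
    frameMap_one]
  exact ⟨rfl, rfl⟩

/-- Linear coordinates on `ℂ⁴` in which a four-vector is a `2 × 2` matrix whose determinant is,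
up to the factor `s`, its Minkowski square, in which `p₃` is the identity matrix, and in
which `p₁` has a nonzero upper off-diagonal entry. -/
structure IsFrame (J : Matrix (Fin 4) (Fin 4) ℂ) (p₁ p₃ : Fin 4 → ℂ) (s : ℂ) : Prop where
  minkowskiSq_eq : ∀ {A : Type} [CommRing A] [Algebra ℂ A] (q : Fin 4 → A),
    minkowskiSq q = algebraMap ℂ A s * splitForm (frameMap J q)
  map_third : frameMap J p₃ = unitVec
  map_first : frameMap J p₁ 1 ≠ 0
  det_sq : J.det ^ 2 = -16 / s ^ 4

theorem IsFrame.det_ne_zero {J : Matrix (Fin 4) (Fin 4) ℂ} {p₁ p₃ : Fin 4 → ℂ} {s : ℂ}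
    (hJ : IsFrame J p₁ p₃ s) (hs : s ≠ 0) : J.det ≠ 0 := by
  intro h
  have h4 : (-16 / s ^ 4 : ℂ) ≠ 0 := div_ne_zero (by norm_num) (pow_ne_zero _ hs)
  exact h4 (by rw [← hJ.det_sq, h]; ring)

section Flag

variable {L : ℕ}

/-- The differential of a series, with the components indexed by loops and space-time directions. -/
def loopGradient (L : ℕ) :
    Derivation ℂ (IteratedLaurent (L * 4)) (Fin L × Fin 4 → IteratedLaurent (L * 4)) :=
  (LinearMap.funLeft (IteratedLaurent (L * 4)) (IteratedLaurent (L * 4))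
    finProdFinEquiv).compDer (logGradient (L * 4))

@[simp] theorem loopGradient_apply (f : IteratedLaurent (L * 4)) (q : Fin L × Fin 4) :
    loopGradient L f q = eulerDeriv (finProdFinEquiv q) f := rfl

/-- The momentum `ℓ_i - p₁`, expanded at the flag and written in the frame `J`. -/
def frameMomentum (J : Matrix (Fin 4) (Fin 4) ℂ) (p₁ : Fin 4 → ℂ)
    (x : Fin (L * 4) → IteratedLaurent (L * 4)) (i : ℕ) : Fin 4 → IteratedLaurent (L * 4) :=
  frameMap J fun μ => aeval x (loopMomentum L i μ) - algebraMap ℂ _ (p₁ μ)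

theorem aeval_loopMomentum_succ (x : Fin (L * 4) → IteratedLaurent (L * 4)) (i : Fin L)
    (μ : Fin 4) : aeval x (loopMomentum L (i + 1) μ) = x (finProdFinEquiv (i, μ)) := by
  simp [loopMomentum]

theorem frameMomentum_zero (J : Matrix (Fin 4) (Fin 4) ℂ) (p₁ : Fin 4 → ℂ)
    (x : Fin (L * 4) → IteratedLaurent (L * 4)) (μ : Fin 4) :
    frameMomentum J p₁ x 0 μ = algebraMap ℂ _ (-frameMap J p₁ μ) := by
  have : (fun μ => aeval x (loopMomentum L 0 μ) - algebraMap ℂ (IteratedLaurent (L * 4)) (p₁ μ)) =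
      fun μ => algebraMap ℂ (IteratedLaurent (L * 4)) (-p₁ μ) := by
    ext1 μ
    simp [loopMomentum]
  rw [frameMomentum, this, frameMap_algebraMap]
  congr 1
  simp [frameMap]

theorem minkowskiSq_neg {R : Type*} [CommRing R] (q : Fin 4 → R) :
    minkowskiSq (-q) = minkowskiSq q := by
  simp [minkowskiSq]

theorem map_minkowskiSq {R S : Type*} [CommRing R] [CommRing S] (φ : R →+* S) (q : Fin 4 → R) :
    φ (minkowskiSq q) = minkowskiSq fun μ => φ (q μ) := by
  simp [minkowskiSq]

theorem aeval_ladderPropagator {J : Matrix (Fin 4) (Fin 4) ℂ} {p₁ p₂ p₃ : Fin 4 → ℂ} {s : ℂ}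
    (hJ : IsFrame J p₁ p₃ s) (hp : p₁ + p₂ + p₃ = 0)
    (x : Fin (L * 4) → IteratedLaurent (L * 4)) (b : IteratedLaurent (L * 4))
    (i : Fin L) (j : Fin 3) :
    aeval x (ladderPropagator L p₁ p₂ (i, j)) = algebraMap ℂ _ s *
      cutFun (frameMomentum J p₁ x i) b (frameMomentum J p₁ x (i + 1)) j.castSucc := by
  have hp₂ : ∀ μ, p₂ μ = -p₁ μ - p₃ μ := fun μ => by
    have := congrFun hp μ
    simp only [Pi.add_apply, Pi.zero_apply] at this
    linear_combination this
  have hunit : frameMap J (fun μ => algebraMap ℂ (IteratedLaurent (L * 4)) (p₃ μ)) = unitVec := by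
    ext1 ν
    rw [frameMap_algebraMap, hJ.map_third]
    fin_cases ν <;> simp [unitVec]
  fin_cases j
  · simp only [ladderPropagator, cutFun, Fin.zero_eta, Matrix.cons_val_zero, Fin.castSucc_zero]
    rw [← RingHom.coe_coe, map_minkowskiSq, frameMomentum, ← hJ.minkowskiSq_eq]
    simp
  · simp only [ladderPropagator, cutFun, Fin.mk_one, Matrix.cons_val_one, Matrix.cons_val_zero,
      Fin.castSucc_one]
    rw [← RingHom.coe_coe, map_minkowskiSq, frameMomentum, ← hunit, ← frameMap_sub,
      ← hJ.minkowskiSq_eq]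
    congr 1
    ext1 μ
    simp only [RingHom.coe_coe, map_add, algHom_C, hp₂, map_sub, map_neg, Pi.sub_apply]
    ring
  · have h2 : (Fin.castSucc 2 : Fin 4) = 2 := rfl
    simp only [ladderPropagator, cutFun, Fin.reduceFinMk, h2, Matrix.cons_val]
    rw [← RingHom.coe_coe, map_minkowskiSq, frameMomentum, frameMomentum, ← frameMap_sub,
      ← hJ.minkowskiSq_eq, ← minkowskiSq_neg]
    congr 1
    ext1 μ
    simp

theorem det_frameMomentum (J : Matrix (Fin 4) (Fin 4) ℂ) (p₁ : Fin 4 → ℂ)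
    (x : Fin (L * 4) → IteratedLaurent (L * 4)) :
    (Matrix.of fun p : Fin L × Fin 4 => loopGradient L (frameMomentum J p₁ x (p.1 + 1) p.2)).det =
      algebraMap ℂ _ J.det ^ L * (Matrix.of fun i k : Fin (L * 4) => eulerDeriv k (x i)).det := by
  rw [← Matrix.det_submatrix_equiv_self finProdFinEquiv
    (Matrix.of fun i k : Fin (L * 4) => eulerDeriv k (x i))]
  have := det_eq_prod_det_mul
    (fun p : Fin L × Fin 4 => loopGradient L (frameMomentum J p₁ x (p.1 + 1) p.2))
    (fun p => loopGradient L (x (finProdFinEquiv p)))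
    (fun _ => J.map (algebraMap ℂ (IteratedLaurent (L * 4)))) (fun i j => by
      have : loopGradient L (frameMomentum J p₁ x (i + 1) j) - ∑ μ,
          J.map (algebraMap ℂ (IteratedLaurent (L * 4))) j μ •
            loopGradient L (x (finProdFinEquiv (i, μ))) = 0 := by
        simp only [frameMomentum, frameMap, aeval_loopMomentum_succ, map_sum, Derivation.leibniz,
          map_sub, Derivation.map_algebraMap, smul_zero, sub_zero, add_zero, Matrix.map_apply,
          sub_self]
      simp only [this]
      exact Submodule.zero_mem _)
  rw [this]
  congr 1
  simp [← RingHom.mapMatrix_apply, ← RingHom.map_det]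

theorem loopGradient_frameMomentum_mem (J : Matrix (Fin 4) (Fin 4) ℂ) (p₁ : Fin 4 → ℂ)
    (x : Fin (L * 4) → IteratedLaurent (L * 4)) (i : Fin L) (μ : Fin 4) :
    loopGradient L (frameMomentum J p₁ x i μ) ∈ Submodule.span (IteratedLaurent (L * 4))
      ((fun p : Fin L × Fin 4 => loopGradient L (frameMomentum J p₁ x (p.1 + 1) p.2)) ''
        {p | p.1 < i}) := by
  obtain ⟨i, hi⟩ := i
  cases i with
  | zero =>
    simp only [frameMomentum_zero, Derivation.map_algebraMap]
    exact Submodule.zero_mem _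
  | succ i => exact Submodule.subset_span ⟨(⟨i, by omega⟩, μ), by simp [Fin.lt_def], rfl⟩

/-- The differentials of the four functions of one loop, modulo the differentials of the momenta of
the previous loops. -/
theorem loopGradient_cutFun_sub_mem {J : Matrix (Fin 4) (Fin 4) ℂ} {p₁ : Fin 4 → ℂ}
    {x : Fin (L * 4) → IteratedLaurent (L * 4)} {i : Fin L} {a b : IteratedLaurent (L * 4)}
    (he : IsEigenpair (frameMomentum J p₁ x i) a b) (hab : a ≠ b) (j : Fin 4) :
    loopGradient L (cutFun (frameMomentum J p₁ x i) b (frameMomentum J p₁ x (i + 1)) j) -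
        ∑ μ, cutJacobian (frameMomentum J p₁ x i) b (frameMomentum J p₁ x (i + 1)) j μ •
          loopGradient L (frameMomentum J p₁ x (i + 1) μ) ∈
      Submodule.span (IteratedLaurent (L * 4))
        ((fun p : Fin L × Fin 4 => loopGradient L (frameMomentum J p₁ x (p.1 + 1) p.2)) ''
          {p | p.1 < i}) :=
  derivation_cutFun_sub_mem _ _ _ (loopGradient_frameMomentum_mem J p₁ x i)
    (he.derivation_mem _ _ hab (loopGradient_frameMomentum_mem J p₁ x i)) j

/-- The matrix of the logarithmic differentials of the propagators and the light-cone
coordinates. -/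
def dlogMatrix (f : Fin L × Fin 4 → IteratedLaurent (L * 4)) :
    Matrix (Fin L × Fin 4) (Fin L × Fin 4) (IteratedLaurent (L * 4)) :=
  Matrix.of fun p q => eulerDeriv (finProdFinEquiv q) (f p) / f p

/-- The integrand of the ladder is, up to the Jacobian factors `a i - b i`, the wedge product of
the logarithmic differentials of the propagators and the light-cone coordinates. -/
theorem dlogCoeff_eq {J : Matrix (Fin 4) (Fin 4) ℂ} {p₁ p₂ p₃ : Fin 4 → ℂ} {s : ℂ}
    (hs : s ≠ 0) (hJ : IsFrame J p₁ p₃ s) (hp : p₁ + p₂ + p₃ = 0) (F : ResidueFlag (L * 4))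
    (a b : ℕ → IteratedLaurent (L * 4))
    (he : ∀ i < L, IsEigenpair (frameMomentum J p₁ F.coord i) (a i) (b i))
    (hab : ∀ i < L, a i ≠ b i) (f : Fin L × Fin 4 → IteratedLaurent (L * 4))
    (hf : ∀ p, f p = cutFun (frameMomentum J p₁ F.coord p.1) (b p.1)
      (frameMomentum J p₁ F.coord (p.1 + 1)) p.2) (hf0 : ∀ p, f p ≠ 0) :
    F.dlogCoeff (loopMeasure L) (ladderPropagator L p₁ p₂) =
      algebraMap ℂ _ (1 / (Complex.I * (Real.pi : ℂ) ^ 2) / (s ^ 3 * J.det)) ^ L *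
        (∏ i : Fin L, (a i - b i))⁻¹ * (dlogMatrix f).det := by
  have hdJ := hJ.det_ne_zero hs
  have hinj := (algebraMap ℂ (IteratedLaurent (L * 4))).injective
  have hs' : algebraMap ℂ (IteratedLaurent (L * 4)) s ≠ 0 := by simpa using hs
  have hdJ' : algebraMap ℂ (IteratedLaurent (L * 4)) J.det ≠ 0 := by
    rw [Ne, map_eq_zero_iff _ hinj]; exact hdJ
  have h1 : (Matrix.of fun p => loopGradient L (f p)).det = (∏ p, f p) * (dlogMatrix f).det := by
    rw [← Matrix.det_mul_column]
    congr 1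
    ext1 p q
    simp only [Matrix.of_apply, loopGradient_apply, dlogMatrix]
    rw [mul_div_cancel₀ _ (hf0 p)]
  have h2 := det_eq_prod_det_mul (fun p => loopGradient L (f p))
    (fun p : Fin L × Fin 4 => loopGradient L (frameMomentum J p₁ F.coord (p.1 + 1) p.2))
    (fun i => cutJacobian (frameMomentum J p₁ F.coord i) (b i) (frameMomentum J p₁ F.coord (i + 1)))
    (fun i j => by
      rw [hf]; exact loopGradient_cutFun_sub_mem (he i i.2) (hab i i.2) j)
  rw [det_frameMomentum, h1] at h2
  have h3 : ∀ i : Fin L, (cutJacobian (frameMomentum J p₁ F.coord i) (b i)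
      (frameMomentum J p₁ F.coord (i + 1))).det = (a i - b i) * f (i, 3) := by
    intro i
    rw [det_cutJacobian (he i i.2), hf]
    rfl
  have h4 : ∏ p, f p = (∏ i : Fin L, (f (i, 0) * f (i, 1) * f (i, 2))) * ∏ i : Fin L, f (i, 3) := by
    rw [Fintype.prod_prod_type, ← Finset.prod_mul_distrib]
    exact Finset.prod_congr rfl fun i _ => by rw [Fin.prod_univ_four]
  have h5 : ∏ j, aeval F.coord (ladderPropagator L p₁ p₂ j) = (algebraMap ℂ (IteratedLaurent (L * 4)) s ^ 3) ^ L *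
      ∏ i : Fin L, (f (i, 0) * f (i, 1) * f (i, 2)) := by
    rw [Fintype.prod_prod_type]
    have : ∀ i : Fin L, ∏ j, aeval F.coord (ladderPropagator L p₁ p₂ (i, j)) =
        algebraMap ℂ (IteratedLaurent (L * 4)) s ^ 3 * (f (i, 0) * f (i, 1) * f (i, 2)) := by
      intro i
      simp only [aeval_ladderPropagator hJ hp _ (b i), hf, Fin.prod_univ_three, Fin.castSucc_zero,
        Fin.castSucc_one]
      rw [show (Fin.castSucc 2 : Fin 4) = 2 from rfl]
      ring
    rw [Finset.prod_congr rfl fun i _ => this i, Finset.prod_mul_distrib]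
    simp
  simp only [h3, Finset.prod_mul_distrib] at h2
  rw [h4] at h2
  have hP : ∏ i : Fin L, (f (i, 0) * f (i, 1) * f (i, 2)) ≠ 0 :=
    Finset.prod_ne_zero_iff.mpr fun i _ => mul_ne_zero (mul_ne_zero (hf0 _) (hf0 _)) (hf0 _)
  have hU : ∏ i : Fin L, f (i, 3) ≠ 0 := Finset.prod_ne_zero_iff.mpr fun i _ => hf0 _
  have hA : ∏ i : Fin L, (a i - b i) ≠ 0 :=
    Finset.prod_ne_zero_iff.mpr fun i _ => sub_ne_zero.mpr (hab i i.2)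
  have hN : aeval F.coord (loopMeasure L) =
      algebraMap ℂ (IteratedLaurent (L * 4)) (1 / (Complex.I * (Real.pi : ℂ) ^ 2)) ^ L := by
    rw [loopMeasure, algHom_C, map_pow]
  rw [ResidueFlag.dlogCoeff, h5, hN]
  generalize (Matrix.of fun i k : Fin (L * 4) => eulerDeriv k (F.coord i)).det = d at *
  generalize (dlogMatrix f).det = e at *
  have h6 : d = (∏ i : Fin L, (f (i, 0) * f (i, 1) * f (i, 2))) * e /
      ((∏ i : Fin L, (a i - b i)) * algebraMap ℂ (IteratedLaurent (L * 4)) J.det ^ L) := by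
    rw [eq_div_iff (mul_ne_zero hA (pow_ne_zero _ hdJ'))]
    apply mul_right_cancel₀ hU
    linear_combination -h2
  rw [h6, map_div₀ _ (1 / (Complex.I * (Real.pi : ℂ) ^ 2)), map_mul, map_pow, div_pow, mul_pow]
  field_simp

end Flag

/-! ### The value of the integrand at the last point of a flag -/

/-- The matrix of the exponents of the leading monomials of the series `f p`. -/
def orderMatrix {L : ℕ} (f : Fin L × Fin 4 → IteratedLaurent (L * 4)) :
    Matrix (Fin L × Fin 4) (Fin L × Fin 4) ℤ :=
  Matrix.of fun p q => ofLex (f p).order (finProdFinEquiv q)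

theorem hasLimit_det_dlogMatrix {L : ℕ} {f : Fin L × Fin 4 → IteratedLaurent (L * 4)}
    (hf : ∀ p, f p ≠ 0) : HasLimit (dlogMatrix f).det ((orderMatrix f).det : ℂ) := by
  have : ((orderMatrix f).det : ℂ) = ((orderMatrix f).map (Int.castRingHom ℂ)).det := by
    rw [← RingHom.mapMatrix_apply, ← RingHom.map_det]; rfl
  rw [this]
  exact HasLimit.det fun p q => hasLimit_dlog (hf p) _

theorem sum_smul_order_apply {L : ℕ} (f : Fin L × Fin 4 → IteratedLaurent (L * 4))
    (c : Fin L × Fin 4 → ℤ) (q : Fin L × Fin 4) :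
    ofLex (∑ p, c p • (f p).order) (finProdFinEquiv q) = Matrix.vecMul c (orderMatrix f) q := by
  have : ofLex (∑ p, c p • (f p).order) = ∑ p, c p • ofLex (f p).order := rfl
  rw [this, Finset.sum_apply]
  rfl

theorem linearIndependent_order {L : ℕ} {f : Fin L × Fin 4 → IteratedLaurent (L * 4)}
    (hdet : (orderMatrix f).det ≠ 0) : LinearIndependent ℤ fun p => (f p).order := by
  rw [Fintype.linearIndependent_iff]
  intro c hc
  have : Matrix.vecMul c (orderMatrix f) = 0 := by
    ext q
    rw [← sum_smul_order_apply, hc]; rfl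
  exact fun p => congrFun (Matrix.eq_zero_of_vecMul_eq_zero hdet this) p

theorem isUnit_det_orderMatrix {L : ℕ} {f : Fin L × Fin 4 → IteratedLaurent (L * 4)}
    (h : ∀ k, unitExponent k ∈ Submodule.span ℤ (Set.range fun p => (f p).order)) :
    IsUnit (orderMatrix f).det := by
  have h' : ∀ q : Fin L × Fin 4, ∃ c : Fin L × Fin 4 → ℤ,
      ∑ p, c p • (f p).order = unitExponent (finProdFinEquiv q) := fun q =>
    (Submodule.mem_span_range_iff_exists_fun ℤ).mp (h _)
  choose c hc using h'
  have : Matrix.of c * orderMatrix f = 1 := by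
    ext q q'
    have := sum_smul_order_apply f (c q) q'
    rw [hc] at this
    change Matrix.vecMul (c q) (orderMatrix f) q' = _
    rw [← this]
    simp [unitExponent, Pi.single_apply, Matrix.one_apply, eq_comm]
  rw [← Matrix.isUnit_iff_isUnit_det]
  exact isUnit_iff_exists_inv'.mpr ⟨_, this⟩

/-- The value of the integrand, relative to `dlog t_0 ∧ ⋯ ∧ dlog t_{n-1}`, at the last point of
the flag. -/
theorem hasLimit_dlogCoeff {L : ℕ} {J : Matrix (Fin 4) (Fin 4) ℂ} {p₁ p₂ p₃ : Fin 4 → ℂ} {s : ℂ}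
    (hs : s ≠ 0) (hJ : IsFrame J p₁ p₃ s) (hp : p₁ + p₂ + p₃ = 0) (F : ResidueFlag (L * 4))
    (a b : ℕ → IteratedLaurent (L * 4)) (α β : ℕ → ℂ)
    (he : ∀ i < L, IsEigenpair (frameMomentum J p₁ F.coord i) (a i) (b i))
    (ha : ∀ i < L, HasLimit (a i) (α i)) (hb : ∀ i < L, HasLimit (b i) (β i))
    (hab : ∀ i < L, α i ≠ β i) (f : Fin L × Fin 4 → IteratedLaurent (L * 4))
    (hf : ∀ p, f p = cutFun (frameMomentum J p₁ F.coord p.1) (b p.1)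
      (frameMomentum J p₁ F.coord (p.1 + 1)) p.2) (hf0 : ∀ p, f p ≠ 0) :
    HasLimit (F.dlogCoeff (loopMeasure L) (ladderPropagator L p₁ p₂))
      ((1 / (Complex.I * (Real.pi : ℂ) ^ 2) / (s ^ 3 * J.det)) ^ L *
        (∏ i : Fin L, (α i - β i))⁻¹ * ((orderMatrix f).det : ℂ)) := by
  have hlim : ∀ i < L, HasLimit (a i - b i) (α i - β i) := fun i hi => (ha i hi).sub (hb i hi)
  rw [dlogCoeff_eq hs hJ hp F a b he (fun i hi h => by
    have := (hlim i hi).ne_zero (sub_ne_zero.mpr (hab i hi))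
    exact this (sub_eq_zero.mpr h)) f hf hf0]
  exact (((HasLimit.algebraMap_const _).pow L).mul ((HasLimit.prod Finset.univ fun (i : Fin L) _ =>
    hlim i i.2).inv (Finset.prod_ne_zero_iff.mpr fun i _ => sub_ne_zero.mpr (hab i i.2)))).mul
    (hasLimit_det_dlogMatrix hf0)

/-- Near a point of the flag where the propagators `y` and `z` vanish, the two eigenvalues are
separated: they are given by the square root of a series with constant term `1`. -/
theorem exists_eigenvalues {n : ℕ} {y z : IteratedLaurent n} (hy : HasLimit y 0)
    (hz : HasLimit z 0) : ∃ a b : IteratedLaurent n, a + b = 1 + y - z ∧ a * b = y ∧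
      HasLimit a 0 ∧ HasLimit b 1 := by
  have ht : HasLimit (1 + y - z) 1 := by simpa using (HasLimit.one.add hy).sub hz
  have hD : HasLimit ((1 + y - z) ^ 2 - algebraMap ℂ _ 4 * y) 1 := by
    simpa using (ht.pow 2).sub ((HasLimit.algebraMap_const 4).mul hy)
  obtain ⟨w, hw, hw1⟩ := hD.exists_sqrt
  have h4 : algebraMap ℂ (IteratedLaurent n) 4 = 4 := map_ofNat _ 4
  have h2 : algebraMap ℂ (IteratedLaurent n) (1 / 2) * 2 = 1 := by
    rw [← map_ofNat (algebraMap ℂ (IteratedLaurent n)) 2, ← map_mul]; norm_num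
  rw [h4] at hw
  refine ⟨algebraMap ℂ _ (1 / 2) * (1 + y - z - w), algebraMap ℂ _ (1 / 2) * (1 + y - z + w),
    ?_, ?_, ?_, ?_⟩
  · linear_combination (1 + y - z) * h2
  · generalize algebraMap ℂ (IteratedLaurent n) (1 / 2) = e at *
    linear_combination -e ^ 2 * hw + y * (e * 2 + 1) * h2
  · simpa using (HasLimit.algebraMap_const (1 / 2)).mul (ht.sub hw1)
  · have := (HasLimit.algebraMap_const (1 / 2)).mul (ht.add hw1)
    norm_num at this ⊢
    exact this

theorem isEigenpair_of_splitForm {R : Type*} [CommRing R] {m : Fin 4 → R} {a b : R}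
    (h1 : a + b = 1 + splitForm m - splitForm (m - unitVec)) (h2 : a * b = splitForm m) :
    IsEigenpair m a b := by
  refine ⟨?_, h2⟩
  rw [h1]
  simp only [splitForm, unitVec, Pi.sub_apply, Matrix.cons_val]
  ring

theorem order_of_eigenvalues {n : ℕ} {y z a b : IteratedLaurent n} (h1 : a + b = 1 + y - z)
    (h2 : a * b = y) (ha : HasLimit a 0) (hb : HasLimit b 1) (hy : y ≠ 0) (hz : z ≠ 0) :
    (a ≠ 0 ∧ a.order = y.order) ∧ 1 - b ≠ 0 ∧ (1 - b).order = z.order := by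
  have h3 : (1 - a) * (1 - b) = z := by linear_combination h2 - h1
  have ha' : HasLimit (1 - a) 1 := by simpa using HasLimit.one.sub ha
  rw [← h2] at hy ⊢
  rw [← h3] at hz ⊢
  refine ⟨⟨left_ne_zero_of_mul hy, ?_⟩, right_ne_zero_of_mul hz, ?_⟩
  · rw [HahnSeries.order_mul (left_ne_zero_of_mul hy) (right_ne_zero_of_mul hy),
      hb.order_eq_zero one_ne_zero, add_zero]
  · rw [HahnSeries.order_mul (left_ne_zero_of_mul hz) (right_ne_zero_of_mul hz),
      ha'.order_eq_zero one_ne_zero, zero_add]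

/-- `solveCut` is a rational function of its arguments. -/
theorem solveCut_mem {K : Type*} [Field K] [Algebra ℂ K] (E : IntermediateField ℂ K)
    {k : Fin 4 → K} {a b y z x B : K} (hk : ∀ μ, k μ ∈ E) (ha : a ∈ E) (hb : b ∈ E) (hy : y ∈ E)
    (hz : z ∈ E) (hx : x ∈ E) (hB : B ∈ E) (μ : Fin 4) : solveCut k a b y z x B μ ∈ E := by
  have : ∃ w : Fin 4 → E, solveCut k a b y z x B = fun μ => (w μ : K) := by
    refine ⟨solveCut (fun μ => ⟨k μ, hk μ⟩) ⟨a, ha⟩ ⟨b, hb⟩ ⟨y, hy⟩ ⟨z, hz⟩ ⟨x, hx⟩ ⟨B, hB⟩, ?_⟩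
    ext1 μ
    fin_cases μ <;> simp [solveCut, ofEigenbasis, diagFst, diagSnd]
  obtain ⟨w, hw⟩ := this
  rw [hw]
  exact (w μ).2

/-- On a flag where the integrand does not vanish, the momentum components `dM` are independent, and
then neither an off-diagonal component of a momentum nor a light-cone coordinate can vanish. -/
theorem lightCone_ne_zero {L : ℕ} {J : Matrix (Fin 4) (Fin 4) ℂ} {p₁ p₃ : Fin 4 → ℂ} {s : ℂ}
    (hJ : IsFrame J p₁ p₃ s) {x : Fin (L * 4) → IteratedLaurent (L * 4)}
    (hdet : (Matrix.of fun p : Fin L × Fin 4 =>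
      loopGradient L (frameMomentum J p₁ x (p.1 + 1) p.2)).det ≠ 0) (i : Fin L) :
    frameMomentum J p₁ x i 1 ≠ 0 ∧ ∀ a b, IsEigenpair (frameMomentum J p₁ x i) a b → a ≠ b →
      lightCone (frameMomentum J p₁ x i) b (frameMomentum J p₁ x (i + 1)) ≠ 0 := by
  have hli : LinearIndependent (IteratedLaurent (L * 4)) fun p : Fin L × Fin 4 =>
      loopGradient L (frameMomentum J p₁ x (p.1 + 1) p.2) :=
    Matrix.linearIndependent_rows_of_det_ne_zero hdet
  have hk : frameMomentum J p₁ x i 1 ≠ 0 := by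
    obtain ⟨i, hi⟩ := i
    cases i with
    | zero =>
      rw [frameMomentum_zero, Ne, map_eq_zero_iff _ (algebraMap ℂ _).injective, neg_eq_zero]
      exact hJ.map_first
    | succ i =>
      intro h
      refine hli.ne_zero (⟨i, by omega⟩, 1) ?_
      change loopGradient L (frameMomentum J p₁ x (i + 1) 1) = 0
      rw [h, map_zero]
  refine ⟨hk, fun a b he hab h0 => ?_⟩
  have hmem := loopGradient_cutFun_sub_mem he hab 3
  have hc : cutFun (frameMomentum J p₁ x i) b (frameMomentum J p₁ x (i + 1)) 3 = 0 := h0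
  rw [hc, map_zero, zero_sub, neg_mem_iff] at hmem
  set T := cutJacobian (frameMomentum J p₁ x i) b (frameMomentum J p₁ x (i + 1)) 3
  set g : Fin L × Fin 4 → Fin L × Fin 4 → IteratedLaurent (L * 4) := fun p =>
    loopGradient L (frameMomentum J p₁ x (p.1 + 1) p.2) with hg
  have hmem2 : ∑ μ, T μ • g (i, μ) ∈ Submodule.span (IteratedLaurent (L * 4))
      (g '' {p | p.1 = i}) :=
    Submodule.sum_mem _ fun μ _ => Submodule.smul_mem _ _ (Submodule.subset_span ⟨(i, μ), rfl, rfl⟩)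
  have hdis : Disjoint {p : Fin L × Fin 4 | p.1 < i} {p | p.1 = i} := by
    rw [Set.disjoint_left]
    exact fun p hp hp' => (ne_of_lt hp) hp'
  have hzero := Submodule.disjoint_def.mp (hli.disjoint_span_image hdis) _ hmem hmem2
  have hli' := hli.comp (fun μ : Fin 4 => (i, μ)) (fun μ ν h => (Prod.mk.inj h).2)
  have := Fintype.linearIndependent_iff.mp hli' T hzero 2
  have hT : T 2 = -frameMomentum J p₁ x i 1 ^ 2 := rfl
  rw [hT, neg_eq_zero] at this
  exact hk (pow_eq_zero_iff two_ne_zero |>.mp this)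

/-! ### Every leading singularity has the asserted value -/

theorem isEigenpair_algebraMap {A : Type*} [CommRing A] [Algebra ℂ A] {k : Fin 4 → ℂ} {a b : ℂ}
    (h : IsEigenpair k a b) :
    IsEigenpair (fun μ => algebraMap ℂ A (k μ)) (algebraMap ℂ A a) (algebraMap ℂ A b) := by
  refine ⟨?_, ?_⟩
  · rw [← map_add, h.1, map_add]
  · rw [← map_mul, h.2]; simp [splitForm]

/-- The value of the Jacobian factors of the loops `1, …, L` on the cut, where `a₀`, `b₀` are the
eigenvalues of `-p₁` relative to `p₃`: the later factors only see the eigenvalues `0` and `1` of a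
matrix `m` with `det m = det (m - 1) = 0`. -/
def cutFactor (L : ℕ) (a₀ b₀ : ℂ) : ℂ :=
  ∏ i : Fin L, ((if (i : ℕ) = 0 then a₀ else 0) - (if (i : ℕ) = 0 then b₀ else 1))

theorem cutFun_order_pos_of_cutsAll {L : ℕ} {J : Matrix (Fin 4) (Fin 4) ℂ}
    {p₁ p₂ p₃ : Fin 4 → ℂ} {s : ℂ} (hs : s ≠ 0) (hJ : IsFrame J p₁ p₃ s) (hp : p₁ + p₂ + p₃ = 0)
    (F : ResidueFlag (L * 4)) (hF : F.CutsAll (ladderPropagator L p₁ p₂)) (i : Fin L) (j : Fin 3)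
    (b : IteratedLaurent (L * 4)) :
    0 < (cutFun (frameMomentum J p₁ F.coord i) b (frameMomentum J p₁ F.coord (i + 1))
      j.castSucc).order := by
  have hs' : algebraMap ℂ (IteratedLaurent (L * 4)) s ≠ 0 := by simpa using hs
  obtain ⟨σ, hσ⟩ := hF
  have h1 := hσ (i, j)
  have hne : aeval F.coord (ladderPropagator L p₁ p₂ (i, j)) ≠ 0 := by
    intro h
    rw [h, HahnSeries.order_zero] at h1
    exact (unitExponent_pos _).ne h1
  rw [aeval_ladderPropagator hJ hp F.coord b] at h1 hne
  have hne' := right_ne_zero_of_mul hne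
  rw [HahnSeries.order_mul hs' hne'] at h1
  have h2 : (algebraMap ℂ (IteratedLaurent (L * 4)) s).order = 0 := HahnSeries.order_C
  rw [h2, zero_add] at h1
  rw [h1]
  exact unitExponent_pos _

theorem ne_zero_of_order_pos {n : ℕ} {f : IteratedLaurent n} (h : 0 < f.order) : f ≠ 0 := by
  rintro rfl
  rw [HahnSeries.order_zero] at h
  exact lt_irrefl _ h

theorem exists_eigenvalue_sequence {L n : ℕ} (y z : ℕ → IteratedLaurent n)
    (hy : ∀ i < L, HasLimit (y i) 0) (hz : ∀ i < L, HasLimit (z i) 0) (a₀ b₀ : ℂ) :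
    ∃ a b : ℕ → IteratedLaurent n, a 0 = algebraMap ℂ _ a₀ ∧ b 0 = algebraMap ℂ _ b₀ ∧
      ∀ i < L, a (i + 1) + b (i + 1) = 1 + y i - z i ∧ a (i + 1) * b (i + 1) = y i ∧
        HasLimit (a (i + 1)) 0 ∧ HasLimit (b (i + 1)) 1 := by
  have hex : ∀ i : ℕ, ∃ ab : IteratedLaurent n × IteratedLaurent n, i < L →
      ab.1 + ab.2 = 1 + y i - z i ∧ ab.1 * ab.2 = y i ∧ HasLimit ab.1 0 ∧ HasLimit ab.2 1 := by
    intro i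
    by_cases hi : i < L
    · obtain ⟨a, b, h⟩ := exists_eigenvalues (hy i hi) (hz i hi)
      exact ⟨(a, b), fun _ => h⟩
    · exact ⟨0, fun h => absurd h hi⟩
  choose ab hab using hex
  exact ⟨fun i => Nat.casesOn i (algebraMap ℂ _ a₀) fun i => (ab i).1,
    fun i => Nat.casesOn i (algebraMap ℂ _ b₀) fun i => (ab i).2, rfl, rfl, hab⟩

/-- The ladder equations are solved rationally: the momenta lie in every field that contains the
eigenvalues, the rung propagators and the light-cone coordinates. -/
theorem momentum_mem {K : Type*} [Field K] [Algebra ℂ K] {L : ℕ} (E : IntermediateField ℂ K)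
    {M : ℕ → Fin 4 → K} {a b : ℕ → K} (hM0 : ∀ μ, M 0 μ ∈ E)
    (he : ∀ i < L, IsEigenpair (M i) (a i) (b i)) (hab : ∀ i < L, a i ≠ b i)
    (ha : ∀ i ≤ L, a i ∈ E) (hb : ∀ i ≤ L, b i ∈ E)
    (hy : ∀ i < L, a (i + 1) * b (i + 1) = splitForm (M (i + 1)))
    (hz : ∀ i < L, a (i + 1) + b (i + 1) =
      1 + splitForm (M (i + 1)) - splitForm (M (i + 1) - unitVec))
    (hx : ∀ i < L, splitForm (M (i + 1) - M i) ∈ E)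
    (hu : ∀ i < L, lightCone (M i) (b i) (M (i + 1)) ∈ E)
    (hk : ∀ i < L, M i 1 ≠ 0) (hu0 : ∀ i < L, lightCone (M i) (b i) (M (i + 1)) ≠ 0) :
    ∀ i ≤ L, ∀ μ, M i μ ∈ E := by
  intro i
  induction i with
  | zero => exact fun _ => hM0
  | succ i ih =>
    intro hi μ
    have hi' := ih (by omega)
    rw [eq_solveCut (he i hi) (hab i hi) (hk i hi) (hu0 i hi)]
    have hyE : splitForm (M (i + 1)) ∈ E := by
      rw [← hy i hi]
      exact E.mul_mem (ha (i + 1) hi) (hb (i + 1) hi)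
    have hzE : splitForm (M (i + 1) - unitVec) ∈ E := by
      have : splitForm (M (i + 1) - unitVec) =
          1 + splitForm (M (i + 1)) - (a (i + 1) + b (i + 1)) := by
        rw [hz i hi]; ring
      rw [this]
      exact E.sub_mem (E.add_mem E.one_mem hyE) (E.add_mem (ha (i + 1) hi) (hb (i + 1) hi))
    have haE' := ha i (by omega)
    have hbE' := hb i (by omega)
    exact solveCut_mem E hi' haE' hbE' hyE hzE (hx i hi)
      (E.div_mem (hu i hi) (E.mul_mem (E.sub_mem hbE' haE') (hi' 1))) μ

theorem coord_mem {L : ℕ} {J : Matrix (Fin 4) (Fin 4) ℂ} (hJ : J.det ≠ 0) (p₁ : Fin 4 → ℂ)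
    (x : Fin (L * 4) → IteratedLaurent (L * 4)) (E : IntermediateField ℂ (IteratedLaurent (L * 4)))
    (hE : ∀ i ≤ L, ∀ μ, frameMomentum J p₁ x i μ ∈ E) (k : Fin (L * 4)) : x k ∈ E := by
  obtain ⟨⟨i, μ⟩, rfl⟩ := finProdFinEquiv.surjective k
  have h1 := congrFun (frameMap_inv hJ (fun μ => aeval x (loopMomentum L (i + 1) μ) -
    algebraMap ℂ _ (p₁ μ))).1 μ
  rw [aeval_loopMomentum_succ] at h1
  rw [← sub_add_cancel (x (finProdFinEquiv (i, μ))) (algebraMap ℂ _ (p₁ μ)), ← h1]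
  exact E.add_mem (E.sum_mem fun ν _ => E.mul_mem (E.algebraMap_mem _) (hE (i + 1) i.2 ν))
    (E.algebraMap_mem _)

/-- If independent exponents are those of generators of a field that contains the coordinates, the
condition that the `t_k` are local parameters says that they generate all of `ℤⁿ`. -/
theorem isUnit_det_orderMatrix_of_coord_mem {L : ℕ} (F : ResidueFlag (L * 4))
    (f g : Fin L × Fin 4 → IteratedLaurent (L * 4)) (hO : (orderMatrix f).det ≠ 0)
    (hg : ∀ p, g p ≠ 0 ∧ (g p).order = (f p).order)
    (hE : ∀ k, F.coord k ∈ IntermediateField.adjoin ℂ (Set.range g)) :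
    IsUnit (orderMatrix f).det := by
  have hgf : (fun p => (g p).order) = fun p => (f p).order := funext fun p => (hg p).2
  have hPE : ∀ P : MvPolynomial (Fin (L * 4)) ℂ,
      aeval F.coord P ∈ IntermediateField.adjoin ℂ (Set.range g) := by
    intro P
    have : aeval F.coord P ∈ Algebra.adjoin ℂ (Set.range F.coord) := by
      rw [Algebra.adjoin_range_eq_range_aeval]
      exact ⟨P, rfl⟩
    exact Algebra.adjoin_le (S := (IntermediateField.adjoin ℂ (Set.range g)).toSubalgebra)
      (by rintro _ ⟨k, rfl⟩; exact hE k) this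
  refine isUnit_det_orderMatrix fun k => ?_
  obtain ⟨A, B, -, -, h⟩ := F.parameter k
  have hli : LinearIndependent ℤ fun p => (g p).order := by
    rw [hgf]; exact linearIndependent_order hO
  rw [← h, ← hgf]
  exact Submodule.sub_mem _ (order_mem_of_mem_adjoin g (fun p => (hg p).1) hli (hPE A))
    (order_mem_of_mem_adjoin g (fun p => (hg p).1) hli (hPE B))

/-- The residue at a flag that cuts all propagators is determined up to the sign `ε`, the determinant
of the exponents of the propagators and light-cone coordinates. -/
theorem exists_unit_mul_of_cutsAll {L : ℕ} {J : Matrix (Fin 4) (Fin 4) ℂ}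
    {p₁ p₂ p₃ : Fin 4 → ℂ} {s : ℂ} (hs : s ≠ 0) (hJ : IsFrame J p₁ p₃ s) (hp : p₁ + p₂ + p₃ = 0)
    {a₀ b₀ : ℂ} (h₀ : IsEigenpair (fun μ => -frameMap J p₁ μ) a₀ b₀) (hab₀ : a₀ ≠ b₀)
    {r : ℂ} (hr : r ≠ 0) (F : ResidueFlag (L * 4)) (hF : F.CutsAll (ladderPropagator L p₁ p₂))
    (hFr : (F.dlogCoeff (loopMeasure L) (ladderPropagator L p₁ p₂)).coeff 0 = r) :
    ∃ ε : ℤˣ, r = (1 / (Complex.I * (Real.pi : ℂ) ^ 2) / (s ^ 3 * J.det)) ^ L *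
      (cutFactor L a₀ b₀)⁻¹ * (ε : ℤ) := by
  obtain ⟨M, hM⟩ : ∃ M, M = frameMomentum J p₁ F.coord := ⟨_, rfl⟩
  have hdJ := hJ.det_ne_zero hs
  have hprop := cutFun_order_pos_of_cutsAll hs hJ hp F hF
  rw [← hM] at hprop
  obtain ⟨a, b, ha0, hb0, hab⟩ := exists_eigenvalue_sequence (L := L)
    (fun i => splitForm (M (i + 1))) (fun i => splitForm (M (i + 1) - unitVec))
    (fun i hi => hasLimit_zero_of_order_pos (hprop ⟨i, hi⟩ 0 0))
    (fun i hi => hasLimit_zero_of_order_pos (hprop ⟨i, hi⟩ 1 0)) a₀ b₀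
  have hM0 : M 0 = fun μ => algebraMap ℂ _ (-frameMap J p₁ μ) := by
    rw [hM]; exact funext fun μ => frameMomentum_zero J p₁ F.coord μ
  have he : ∀ i < L, IsEigenpair (M i) (a i) (b i) := by
    intro i hi
    cases i with
    | zero => rw [hM0, ha0, hb0]; exact isEigenpair_algebraMap h₀
    | succ i =>
      have := hab i (by omega)
      exact isEigenpair_of_splitForm this.1 this.2.1
  have ha : ∀ i < L, HasLimit (a i) (if i = 0 then a₀ else 0) := by
    intro i hi
    cases i with
    | zero => rw [ha0]; exact HasLimit.algebraMap_const a₀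
    | succ i => simpa using (hab i (by omega)).2.2.1
  have hb : ∀ i < L, HasLimit (b i) (if i = 0 then b₀ else 1) := by
    intro i hi
    cases i with
    | zero => rw [hb0]; exact HasLimit.algebraMap_const b₀
    | succ i => simpa using (hab i (by omega)).2.2.2
  have hne : ∀ i < L, (if i = 0 then a₀ else 0) ≠ (if i = 0 then b₀ else (1 : ℂ)) := by
    intro i _
    split_ifs <;> simp [hab₀]
  have habne : ∀ i < L, a i ≠ b i := fun i hi h =>
    ((ha i hi).sub (hb i hi)).ne_zero (sub_ne_zero.mpr (hne i hi)) (sub_eq_zero.mpr h)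
  -- A nonvanishing residue forces the remaining coordinates of the loops to be nonzero.
  have hdet : (Matrix.of fun p : Fin L × Fin 4 => loopGradient L (M (p.1 + 1) p.2)).det ≠ 0 := by
    rw [hM, det_frameMomentum]
    refine mul_ne_zero (pow_ne_zero _ ?_) fun h => hr ?_
    · rwa [Ne, map_eq_zero_iff _ (algebraMap ℂ _).injective]
    · rw [← hFr, ResidueFlag.dlogCoeff, h, mul_zero, HahnSeries.coeff_zero]
  have hu : ∀ i : Fin L, M i 1 ≠ 0 ∧ lightCone (M i) (b i) (M (i + 1)) ≠ 0 := by
    intro i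
    rw [hM] at hdet he ⊢
    have := lightCone_ne_zero hJ hdet i
    exact ⟨this.1, this.2 _ _ (he i i.2) (habne i i.2)⟩
  obtain ⟨f, hf⟩ : ∃ f : Fin L × Fin 4 → IteratedLaurent (L * 4),
      ∀ p, f p = cutFun (M p.1) (b p.1) (M (p.1 + 1)) p.2 := ⟨_, fun _ => rfl⟩
  have hf0 : ∀ p, f p ≠ 0 := by
    rintro ⟨i, j⟩
    rw [hf]
    refine Fin.lastCases ?_ (fun j => ?_) j
    · exact (hu i).2
    · exact ne_zero_of_order_pos (hprop i j _)
  have hlimit := (hasLimit_dlogCoeff hs hJ hp F a b _ _ (hM ▸ he) ha hb hne f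
    (hM ▸ hf) hf0).coeff_zero
  rw [hFr] at hlimit
  have hO : (orderMatrix f).det ≠ 0 := by
    intro h
    rw [h] at hlimit
    exact hr (by simpa using hlimit)
  -- Generators of a field that contains all coordinates, with the same orders as the `f p`.
  obtain ⟨g, hg⟩ : ∃ g : Fin L × Fin 4 → IteratedLaurent (L * 4), ∀ i : Fin L,
      g (i, 0) = a (i + 1) ∧ g (i, 1) = 1 - b (i + 1) ∧ g (i, 2) = f (i, 2) ∧
        g (i, 3) = f (i, 3) :=
    ⟨fun p => ![a (p.1 + 1), 1 - b (p.1 + 1), f (p.1, 2), f (p.1, 3)] p.2,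
      fun i => ⟨rfl, rfl, rfl, rfl⟩⟩
  have hgf : ∀ p, g p ≠ 0 ∧ (g p).order = (f p).order := by
    rintro ⟨i, j⟩
    have h := hab i i.2
    have e0 : f (i, 0) = splitForm (M (i + 1)) := hf _
    have e1 : f (i, 1) = splitForm (M (i + 1) - unitVec) := hf _
    have h' := order_of_eigenvalues h.1 h.2.1 h.2.2.1 h.2.2.2 (e0 ▸ hf0 (i, 0)) (e1 ▸ hf0 (i, 1))
    rw [← e0, ← e1] at h'
    obtain ⟨g0, g1, g2, g3⟩ := hg i
    rw [← g0, ← g1] at h'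
    fin_cases j
    · exact h'.1
    · exact h'.2
    · exact ⟨g2 ▸ hf0 (i, 2), congrArg _ g2⟩
    · exact ⟨g3 ▸ hf0 (i, 3), congrArg _ g3⟩
  have hcE : ∀ k, F.coord k ∈ IntermediateField.adjoin ℂ (Set.range g) := by
    obtain ⟨E, hE⟩ : ∃ E, E = IntermediateField.adjoin ℂ (Set.range g) := ⟨_, rfl⟩
    have hgE : ∀ p, g p ∈ E := fun p => by
      rw [hE]; exact IntermediateField.subset_adjoin ℂ _ ⟨p, rfl⟩
    rw [← hE]
    refine coord_mem hdJ p₁ F.coord E ?_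
    rw [← hM]
    refine momentum_mem E (fun μ => ?_) he habne (fun i hi => ?_) (fun i hi => ?_)
      (fun i hi => (hab i hi).2.1) (fun i hi => (hab i hi).1) (fun i hi => ?_) (fun i hi => ?_)
      (fun i hi => (hu ⟨i, hi⟩).1) (fun i hi => (hu ⟨i, hi⟩).2)
    · rw [hM0]
      exact E.algebraMap_mem _
    · cases i with
      | zero => rw [ha0]; exact E.algebraMap_mem a₀
      | succ i => rw [← (hg ⟨i, hi⟩).1]; exact hgE _
    · cases i with
      | zero => rw [hb0]; exact E.algebraMap_mem b₀
      | succ i =>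
        rw [← sub_sub_cancel 1 (b (i + 1)), ← (hg ⟨i, hi⟩).2.1]
        exact E.sub_mem E.one_mem (hgE _)
    · have e : f (⟨i, hi⟩, 2) = splitForm (M (i + 1) - M i) := hf _
      rw [← e, ← (hg ⟨i, hi⟩).2.2.1]
      exact hgE _
    · have e : f (⟨i, hi⟩, 3) = lightCone (M i) (b i) (M (i + 1)) := hf _
      rw [← e, ← (hg ⟨i, hi⟩).2.2.2]
      exact hgE _
  obtain ⟨ε, hε⟩ := isUnit_det_orderMatrix_of_coord_mem F f g hO hgf hcE
  exact ⟨ε, by rw [hε]; exact hlimit⟩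

/-! ### A flag that realises the leading singularities -/

theorem solveCut_one_eq {K : Type*} [Field K] {k : Fin 4 → K} {a b τ : K} (y z x : K)
    (hab : b - a ≠ 0) (hτ : τ ≠ 0) : solveCut k a b y z x τ⁻¹ 1 =
      k 1 * τ⁻¹ * ((1 + τ * (diagSnd a b y z x - diagFst a b y z x) -
        (diagFst a b y z x * diagSnd a b y z x - y) * τ ^ 2) / (b - a)) := by
  simp only [solveCut, ofEigenbasis, Matrix.cons_val_one, Matrix.cons_val_zero]
  generalize diagSnd a b y z x = D
  generalize diagFst a b y z x = A
  field_simp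
  ring

/-- If the upper off-diagonal entry `τ⁻¹` in the eigenbasis of `k` tends to infinity, it dominates
the other entries, and it determines the upper off-diagonal entry in the original basis. -/
theorem solveCut_one {n : ℕ} {k : Fin 4 → IteratedLaurent n} {a b y z x τ : IteratedLaurent n}
    {α β : ℂ} (ha : HasLimit a α) (hb : HasLimit b β) (hαβ : α ≠ β) (hy : HasLimit y 0)
    (hz : HasLimit z 0) (hx : HasLimit x 0) (hτ : HasLimit τ 0) (hτ0 : τ ≠ 0) (hk : k 1 ≠ 0) :
    solveCut k a b y z x τ⁻¹ 1 ≠ 0 ∧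
      (solveCut k a b y z x τ⁻¹ 1).order = (k 1).order - τ.order := by
  have hβα : β - α ≠ 0 := sub_ne_zero.mpr hαβ.symm
  have hba := hb.sub ha
  obtain ⟨A, hA⟩ : ∃ c, HasLimit (diagFst a b y z x) c :=
    ⟨_, (((hy.sub hx).add (ha.mul hb)).sub (ha.mul ((hy.sub hz).add HasLimit.one))).div hba hβα⟩
  obtain ⟨D, hD⟩ : ∃ c, HasLimit (diagSnd a b y z x) c :=
    ⟨_, ((hb.mul ((hy.sub hz).add HasLimit.one)).sub ((hy.sub hx).add (ha.mul hb))).div hba hβα⟩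
  have hU := ((HasLimit.one.add (hτ.mul (hD.sub hA))).sub
    (((hA.mul hD).sub hy).mul (hτ.pow 2))).div hba hβα
  have hγ : (1 + 0 * (D - A) - (A * D - 0) * 0 ^ 2) / (β - α) ≠ 0 := by
    simpa using hβα
  have hU0 := hU.ne_zero hγ
  have hU1 := hU.order_eq_zero hγ
  have hτ' := inv_ne_zero hτ0
  rw [solveCut_one_eq y z x (hba.ne_zero hβα) hτ0]
  refine ⟨mul_ne_zero (mul_ne_zero hk hτ') hU0, ?_⟩
  rw [HahnSeries.order_mul (mul_ne_zero hk hτ') hU0, HahnSeries.order_mul hk hτ',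
    hU1, order_inv hτ0]
  abel

/-- The exponents of the light-cone coordinates on a flag that realises the leading singularities:
the coordinate of each loop is a parameter to the power `-1` times the coordinate of the
previous loop. -/
def lightConeExponent (L i : ℕ) : Lex (Fin (L * 4) → ℤ) :=
  -∑ i' : Fin L with i'.val < i, unitExponent (finProdFinEquiv (i', (3 : Fin 4)))

theorem lightConeExponent_zero (L : ℕ) : lightConeExponent L 0 = 0 := by
  simp [lightConeExponent]

theorem lightConeExponent_succ {L : ℕ} (i : Fin L) : lightConeExponent L (i + 1) =
    lightConeExponent L i - unitExponent (finProdFinEquiv (i, (3 : Fin 4))) := by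
  have : (Finset.univ.filter fun i' : Fin L => i'.val < i + 1) =
      insert i (Finset.univ.filter fun i' : Fin L => i'.val < i) := by
    ext j
    simp only [Finset.mem_filter, Finset.mem_univ, true_and, Finset.mem_insert, Fin.ext_iff]
    omega
  rw [lightConeExponent, this, Finset.sum_insert (by simp), lightConeExponent]
  abel

/-- The exponents of the propagators and of the light-cone coordinates on a flag that realises the
leading singularities. -/
def ladderExponent (L : ℕ) (p : Fin L × Fin 4) : Lex (Fin (L * 4) → ℤ) :=
  if p.2 = 3 then lightConeExponent L (p.1 + 1) else unitExponent (finProdFinEquiv p)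

/-- The matrix of the exponents `ladderExponent`. -/
def ladderExponentMatrix (L : ℕ) : Matrix (Fin L × Fin 4) (Fin L × Fin 4) ℤ :=
  Matrix.of fun p q => ofLex (ladderExponent L p) (finProdFinEquiv q)

theorem unitExponent_mem_span_ladderExponent {L : ℕ} (k : Fin (L * 4)) :
    unitExponent k ∈ Submodule.span ℤ (Set.range (ladderExponent L)) := by
  have hlc : ∀ i ≤ L, lightConeExponent L i ∈ Submodule.span ℤ (Set.range (ladderExponent L)) := by
    intro i hi
    cases i with
    | zero => rw [lightConeExponent_zero]; exact Submodule.zero_mem _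
    | succ i => exact Submodule.subset_span ⟨(⟨i, hi⟩, 3), by simp [ladderExponent]⟩
  obtain ⟨⟨i, j⟩, rfl⟩ := finProdFinEquiv.surjective k
  by_cases hj : j = 3
  · subst hj
    have : unitExponent (finProdFinEquiv (i, (3 : Fin 4))) =
        lightConeExponent L i - lightConeExponent L (i + 1) := by
      rw [lightConeExponent_succ]; abel
    rw [this]
    exact Submodule.sub_mem _ (hlc i i.2.le) (hlc (i + 1) i.2)
  · exact Submodule.subset_span ⟨(i, j), by simp [ladderExponent, hj]⟩

theorem exists_loopParameters (L : ℕ) : ∃ t : ℕ → Fin 4 → IteratedLaurent (L * 4),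
    ∀ (i : Fin L) j, t i j ≠ 0 ∧ (t i j).order = unitExponent (finProdFinEquiv (i, j)) := by
  refine ⟨fun i j => if h : i < L then
    HahnSeries.single (unitExponent (finProdFinEquiv ((⟨i, h⟩ : Fin L), j))) 1 else 0, ?_⟩
  intro i j
  simp only [i.2, dite_true]
  exact ⟨by simp, HahnSeries.order_single one_ne_zero⟩

/-- A sequence of momenta that solves the ladder equations, where the three propagators of each loop
and the inverse of a light-cone coordinate are prescribed. -/
theorem exists_momenta {L n : ℕ} {M₀ : Fin 4 → ℂ} {a₀ b₀ : ℂ} (h₀ : IsEigenpair M₀ a₀ b₀)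
    (hab₀ : a₀ ≠ b₀) (hM₀ : M₀ 1 ≠ 0) (t : ℕ → Fin 4 → IteratedLaurent n)
    (ht0 : ∀ i < L, ∀ j, t i j ≠ 0) (ht : ∀ i < L, ∀ j, HasLimit (t i j) 0) :
    ∃ (M : ℕ → Fin 4 → IteratedLaurent n) (a b : ℕ → IteratedLaurent n),
      (∀ μ, M 0 μ = algebraMap ℂ _ (M₀ μ)) ∧ ∀ i < L, IsEigenpair (M i) (a i) (b i) ∧
        HasLimit (a i) (if i = 0 then a₀ else 0) ∧ HasLimit (b i) (if i = 0 then b₀ else 1) ∧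
        M i 1 ≠ 0 ∧ M (i + 1) 1 ≠ 0 ∧ (M (i + 1) 1).order = (M i 1).order - (t i 3).order ∧
        cutFun (M i) (b i) (M (i + 1)) =
          ![t i 0, t i 1, t i 2, (b i - a i) * M i 1 * (t i 3)⁻¹] := by
  obtain ⟨a, b, ha0, hb0, hab⟩ := exists_eigenvalue_sequence (L := L) (fun i => t i 0)
    (fun i => t i 1) (fun i hi => ht i hi 0) (fun i hi => ht i hi 1) a₀ b₀
  obtain ⟨M, hM0, hMs⟩ : ∃ M : ℕ → Fin 4 → IteratedLaurent n,
      (M 0 = fun μ => algebraMap ℂ _ (M₀ μ)) ∧ ∀ i, M (i + 1) =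
        solveCut (M i) (a i) (b i) (t i 0) (t i 1) (t i 2) (t i 3)⁻¹ :=
    ⟨fun i => Nat.rec (fun μ => algebraMap ℂ _ (M₀ μ))
      (fun i m => solveCut m (a i) (b i) (t i 0) (t i 1) (t i 2) (t i 3)⁻¹) i, rfl, fun _ => rfl⟩
  have ha : ∀ i < L, HasLimit (a i) (if i = 0 then a₀ else 0) := by
    intro i hi
    cases i with
    | zero => rw [ha0]; exact HasLimit.algebraMap_const a₀
    | succ i => simpa using (hab i (by omega)).2.2.1
  have hb : ∀ i < L, HasLimit (b i) (if i = 0 then b₀ else 1) := by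
    intro i hi
    cases i with
    | zero => rw [hb0]; exact HasLimit.algebraMap_const b₀
    | succ i => simpa using (hab i (by omega)).2.2.2
  have hne : ∀ i < L, (if i = 0 then a₀ else 0) ≠ (if i = 0 then b₀ else (1 : ℂ)) := by
    intro i _
    split_ifs <;> simp [hab₀]
  have habne : ∀ i < L, a i ≠ b i := fun i hi h =>
    ((ha i hi).sub (hb i hi)).ne_zero (sub_ne_zero.mpr (hne i hi)) (sub_eq_zero.mpr h)
  have hcut : ∀ i < L, IsEigenpair (M i) (a i) (b i) → M i 1 ≠ 0 →
      cutFun (M i) (b i) (M (i + 1)) =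
        ![t i 0, t i 1, t i 2, (b i - a i) * M i 1 * (t i 3)⁻¹] := by
    intro i hi he hk
    rw [hMs i]
    exact cutFun_solveCut he (habne i hi) hk (inv_ne_zero (ht0 i hi 3)) _ _ _
  have hstep : ∀ i < L, M i 1 ≠ 0 → M (i + 1) 1 ≠ 0 ∧
      (M (i + 1) 1).order = (M i 1).order - (t i 3).order := by
    intro i hi hk
    rw [hMs i]
    exact solveCut_one (ha i hi) (hb i hi) (hne i hi) (ht i hi 0) (ht i hi 1) (ht i hi 2)
      (ht i hi 3) (ht0 i hi 3) hk
  have hind : ∀ i < L, IsEigenpair (M i) (a i) (b i) ∧ M i 1 ≠ 0 := by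
    intro i
    induction i with
    | zero =>
      intro _
      rw [hM0, ha0, hb0]
      refine ⟨isEigenpair_algebraMap h₀, ?_⟩
      rwa [Ne, map_eq_zero_iff _ (algebraMap ℂ _).injective]
    | succ i ih =>
      intro hi
      have hi' : i < L := by omega
      obtain ⟨he, hk⟩ := ih hi'
      have hc := hcut i hi' he hk
      have e0 : splitForm (M (i + 1)) = t i 0 := congrFun hc 0
      have e1 : splitForm (M (i + 1) - unitVec) = t i 1 := congrFun hc 1
      have h := hab i hi'
      refine ⟨isEigenpair_of_splitForm ?_ ?_, (hstep i hi' hk).1⟩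
      · rw [e0, e1]; exact h.1
      · rw [e0]; exact h.2.1
  refine ⟨M, a, b, fun μ => congrFun hM0 μ, fun i hi => ?_⟩
  obtain ⟨he, hk⟩ := hind i hi
  exact ⟨he, ha i hi, hb i hi, hk, (hstep i hi hk).1, (hstep i hi hk).2, hcut i hi he hk⟩

theorem exists_polynomial_frameMomentum {L : ℕ} (J : Matrix (Fin 4) (Fin 4) ℂ) (p₁ : Fin 4 → ℂ)
    (x : Fin (L * 4) → IteratedLaurent (L * 4)) (i : ℕ) (ν : Fin 4) :
    ∃ P : MvPolynomial (Fin (L * 4)) ℂ, aeval x P = frameMomentum J p₁ x i ν := by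
  refine ⟨∑ μ, C (J ν μ) * (loopMomentum L i μ - C (p₁ μ)), ?_⟩
  simp only [map_sum, map_mul, map_sub, algHom_C, frameMomentum, frameMap]

/-- Coordinates for which `frameMomentum` is a given sequence of momenta. -/
theorem exists_coord {L : ℕ} {J : Matrix (Fin 4) (Fin 4) ℂ} (hJ : J.det ≠ 0) (p₁ : Fin 4 → ℂ)
    (M : ℕ → Fin 4 → IteratedLaurent (L * 4))
    (hM : ∀ μ, M 0 μ = algebraMap ℂ _ (-frameMap J p₁ μ)) :
    ∃ x : Fin (L * 4) → IteratedLaurent (L * 4), ∀ i ≤ L, frameMomentum J p₁ x i = M i := by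
  refine ⟨fun k => frameMap J⁻¹ (M ((finProdFinEquiv.symm k).1 + 1)) (finProdFinEquiv.symm k).2 +
    algebraMap ℂ _ (p₁ (finProdFinEquiv.symm k).2), fun i hi => ?_⟩
  cases i with
  | zero => ext1 μ; rw [frameMomentum_zero, hM]
  | succ i =>
    rw [← (frameMap_inv hJ (M (i + 1))).2, frameMomentum]
    congr 1
    ext1 μ
    rw [aeval_loopMomentum_succ _ ⟨i, hi⟩]
    simp

/-- There is a flag with the exponents `ladderExponent L`, for each order of the two eigenvalues. -/
theorem exists_flag {L : ℕ} {J : Matrix (Fin 4) (Fin 4) ℂ}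
    {p₁ p₂ p₃ : Fin 4 → ℂ} {s : ℂ} (hs : s ≠ 0) (hJ : IsFrame J p₁ p₃ s) (hp : p₁ + p₂ + p₃ = 0)
    {a₀ b₀ : ℂ} (h₀ : IsEigenpair (fun μ => -frameMap J p₁ μ) a₀ b₀) (hab₀ : a₀ ≠ b₀) :
    IsUnit (ladderExponentMatrix L).det ∧ ∃ F : ResidueFlag (L * 4),
      F.CutsAll (ladderPropagator L p₁ p₂) ∧
      HasLimit (F.dlogCoeff (loopMeasure L) (ladderPropagator L p₁ p₂))
        ((1 / (Complex.I * (Real.pi : ℂ) ^ 2) / (s ^ 3 * J.det)) ^ L *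
          (cutFactor L a₀ b₀)⁻¹ * ((ladderExponentMatrix L).det : ℂ)) := by
  obtain ⟨t, ht⟩ := exists_loopParameters L
  have ht1 : ∀ i < L, ∀ j, HasLimit (t i j) 0 := fun i hi j => by
    apply hasLimit_zero_of_order_pos
    rw [(ht ⟨i, hi⟩ j).2]
    exact unitExponent_pos _
  obtain ⟨M, a, b, hM0, hM⟩ := exists_momenta (L := L) h₀ hab₀ (neg_ne_zero.mpr hJ.map_first) t
    (fun i hi j => (ht ⟨i, hi⟩ j).1) ht1
  obtain ⟨x, hx⟩ := exists_coord (hJ.det_ne_zero hs) p₁ M hM0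
  have hne : ∀ i < L, (if i = 0 then a₀ else 0) ≠ (if i = 0 then b₀ else (1 : ℂ)) := by
    intro i _
    split_ifs <;> simp [hab₀]
  -- The orders of the off-diagonal entries of the momenta.
  have hord : ∀ i ≤ L, (M i 1).order = lightConeExponent L i := by
    intro i
    induction i with
    | zero =>
      intro _
      rw [hM0, lightConeExponent_zero]
      exact HahnSeries.order_C
    | succ i ih =>
      intro hi
      rw [(hM i hi).2.2.2.2.2.1, ih (by omega), (ht ⟨i, hi⟩ 3).2]
      exact (lightConeExponent_succ ⟨i, hi⟩).symm
  have hM1 : ∀ i ≤ L, M i 1 ≠ 0 := by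
    intro i hi
    cases i with
    | zero =>
      rw [hM0, Ne, map_eq_zero_iff _ (algebraMap ℂ _).injective]
      exact neg_ne_zero.mpr hJ.map_first
    | succ i => exact (hM i hi).2.2.2.2.1
  obtain ⟨f, hf⟩ : ∃ f : Fin L × Fin 4 → IteratedLaurent (L * 4),
      ∀ p, f p = cutFun (M p.1) (b p.1) (M (p.1 + 1)) p.2 := ⟨_, fun _ => rfl⟩
  have hford : ∀ p, f p ≠ 0 ∧ (f p).order = ladderExponent L p := by
    rintro ⟨i, j⟩
    obtain ⟨he, ha, hb, hk, hk', -, hc⟩ := hM i i.2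
    rw [hf]
    simp only [hc]
    have hba := hb.sub ha
    have hba' := sub_ne_zero.mpr (hne i i.2).symm
    fin_cases j
    · exact ht i 0
    · exact ht i 1
    · exact ht i 2
    · have hτ := inv_ne_zero (ht i 3).1
      have hlast : ladderExponent L (i, 3) = lightConeExponent L (i + 1) := by
        simp [ladderExponent]
      change (b i - a i) * M i 1 * (t i 3)⁻¹ ≠ 0 ∧
        ((b i - a i) * M i 1 * (t i 3)⁻¹).order = ladderExponent L (i, 3)
      refine ⟨mul_ne_zero (mul_ne_zero (hba.ne_zero hba') hk) hτ, ?_⟩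
      rw [HahnSeries.order_mul (mul_ne_zero (hba.ne_zero hba') hk) hτ,
        HahnSeries.order_mul (hba.ne_zero hba') hk, hba.order_eq_zero hba', order_inv (ht i 3).1,
        hord i i.2.le, (ht i 3).2, hlast, lightConeExponent_succ]
      abel
  have hs' : algebraMap ℂ (IteratedLaurent (L * 4)) s ≠ 0 := by simpa using hs
  have hprop : ∀ (i : Fin L) (j : Fin 3), aeval x (ladderPropagator L p₁ p₂ (i, j)) ≠ 0 ∧
      (aeval x (ladderPropagator L p₁ p₂ (i, j))).order =
        unitExponent (finProdFinEquiv (i, j.castSucc)) := by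
    intro i j
    have h := hford (i, j.castSucc)
    rw [aeval_ladderPropagator hJ hp x (b i), hx i i.2.le, hx (i + 1) i.2]
    have hfij : cutFun (M i) (b i) (M (i + 1)) j.castSucc = f (i, j.castSucc) := by rw [hf]
    have h3 : j.castSucc ≠ 3 := Fin.castSucc_ne_last j
    have h2 : (algebraMap ℂ (IteratedLaurent (L * 4)) s).order = 0 := HahnSeries.order_C
    rw [hfij]
    refine ⟨mul_ne_zero hs' h.1, ?_⟩
    rw [HahnSeries.order_mul hs' h.1, h.2, h2, zero_add]
    simp [ladderExponent, h3]
  have hparam : ∀ k : Fin (L * 4), ∃ A B : MvPolynomial (Fin (L * 4)) ℂ,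
      aeval x A ≠ 0 ∧ aeval x B ≠ 0 ∧ (aeval x A).order - (aeval x B).order = unitExponent k := by
    intro k
    obtain ⟨⟨i, j⟩, rfl⟩ := finProdFinEquiv.surjective k
    refine Fin.lastCases ?_ (fun j => ?_) j
    · obtain ⟨A, hA⟩ := exists_polynomial_frameMomentum J p₁ x i 1
      obtain ⟨B, hB⟩ := exists_polynomial_frameMomentum J p₁ x (i + 1) 1
      refine ⟨A, B, ?_⟩
      rw [hA, hB, hx i i.2.le, hx (i + 1) i.2]
      refine ⟨hM1 i i.2.le, hM1 (i + 1) i.2, ?_⟩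
      rw [hord i i.2.le, hord (i + 1) i.2, lightConeExponent_succ, sub_sub_cancel]
      rfl
    · refine ⟨ladderPropagator L p₁ p₂ (i, j), 1, (hprop i j).1, by simp, ?_⟩
      rw [(hprop i j).2, map_one, HahnSeries.order_one, sub_zero]
  have hmat : orderMatrix f = ladderExponentMatrix L := by
    ext p q
    simp only [orderMatrix, ladderExponentMatrix, Matrix.of_apply, (hford p).2]
  have hrange : (fun p => (f p).order) = ladderExponent L := funext fun p => (hford p).2
  refine ⟨?_, ⟨x, hparam⟩, ⟨⟨fun p => finProdFinEquiv (p.1, p.2.castSucc), ?_⟩, ?_⟩, ?_⟩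
  · rw [← hmat]
    refine isUnit_det_orderMatrix fun k => ?_
    rw [hrange]
    exact unitExponent_mem_span_ladderExponent k
  · rintro ⟨i, j⟩ ⟨i', j'⟩ h
    simpa using h
  · rintro ⟨i, j⟩
    exact (hprop i j).2
  · rw [← hmat]
    refine hasLimit_dlogCoeff hs hJ hp ⟨x, hparam⟩ a b _ _ (fun i hi => ?_)
      (fun i hi => (hM i hi).2.1) (fun i hi => (hM i hi).2.2.1) hne f (fun p => ?_)
      (fun p => (hford p).1)
    · rw [hx i hi.le]
      exact (hM i hi).1
    · rw [hx p.1 p.1.2.le, hx (p.1 + 1) p.1.2]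
      exact hf p

/-! ### Adapted coordinates on the space of four-vectors -/

/-- The coordinates of a four-vector as a `2 × 2` matrix `q⁰ + q³ σ₃ + q¹ σ₁ - q² σ₂`, written with
Pauli matrices. -/
def pauliMatrix : Matrix (Fin 4) (Fin 4) ℂ :=
  !![1, 0, 0, 1; 0, 1, Complex.I, 0; 0, 1, -Complex.I, 0; 1, 0, 0, -1]

/-- Multiplication from the right by the `2 × 2` matrix `!![y 0, y 1; y 2, y 3]`. -/
def rightMulMatrix (y : Fin 4 → ℂ) : Matrix (Fin 4) (Fin 4) ℂ :=
  !![y 0, y 2, 0, 0; y 1, y 3, 0, 0; 0, 0, y 0, y 2; 0, 0, y 1, y 3]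

/-- Conjugation by the `2 × 2` matrix `!![1, τ; 0, 1]`. -/
def conjMatrix (τ : ℂ) : Matrix (Fin 4) (Fin 4) ℂ :=
  !![1, 0, τ, 0; -τ, 1, -τ ^ 2, τ; 0, 0, 1, 0; 0, 0, -τ, 1]

section

variable {A : Type*} [CommRing A] [Algebra ℂ A]

theorem splitForm_pauliMatrix (q : Fin 4 → A) :
    splitForm (frameMap pauliMatrix q) = minkowskiSq q := by
  have hI : algebraMap ℂ A Complex.I * algebraMap ℂ A Complex.I = -1 := by
    rw [← map_mul, Complex.I_mul_I, map_neg, map_one]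
  simp [splitForm, frameMap, pauliMatrix, Fin.sum_univ_four, minkowskiSq]
  linear_combination q 2 ^ 2 * hI

theorem splitForm_rightMulMatrix (y : Fin 4 → ℂ) (m : Fin 4 → A) :
    splitForm (frameMap (rightMulMatrix y) m) = algebraMap ℂ A (splitForm y) * splitForm m := by
  simp [splitForm, frameMap, rightMulMatrix, Fin.sum_univ_four]
  ring

theorem splitForm_conjMatrix (τ : ℂ) (m : Fin 4 → A) :
    splitForm (frameMap (conjMatrix τ) m) = splitForm m := by
  simp [splitForm, frameMap, conjMatrix, Fin.sum_univ_four]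
  ring

end

theorem det_pauliMatrix : pauliMatrix.det ^ 2 = -16 := by
  have : pauliMatrix.det = 4 * Complex.I := by
    simp [pauliMatrix, Matrix.det_succ_row_zero, Fin.sum_univ_succ, Fin.succAbove]
    ring
  rw [this, mul_pow, Complex.I_sq]
  norm_num

theorem det_rightMulMatrix (y : Fin 4 → ℂ) : (rightMulMatrix y).det = splitForm y ^ 2 := by
  simp [rightMulMatrix, Matrix.det_succ_row_zero, Fin.sum_univ_succ, Fin.succAbove, splitForm]
  ring

theorem det_conjMatrix (τ : ℂ) : (conjMatrix τ).det = 1 := by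
  simp [conjMatrix, Matrix.det_succ_row_zero, Fin.sum_univ_succ, Fin.succAbove]

theorem kallen_one_eq (x y : ℂ) : kallen 1 x y = (1 + x - y) ^ 2 - 4 * x := by
  rw [kallen]; ring

/-- The frame is `q ↦ Q (q p₃⁻¹) Q⁻¹` for `2 × 2` matrices, with a unipotent `Q` that makes an
off-diagonal entry of `p₁` nonzero; it exists because `p₁` is not a multiple of `p₃`, the Källén
function being nonzero. -/
theorem exists_isFrame {p₁ p₂ p₃ : Fin 4 → ℂ} (hp : p₁ + p₂ + p₃ = 0) (h₃ : minkowskiSq p₃ ≠ 0)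
    (hK : kallen 1 (minkowskiSq p₁ / minkowskiSq p₃) (minkowskiSq p₂ / minkowskiSq p₃) ≠ 0) :
    ∃ J, IsFrame J p₁ p₃ (minkowskiSq p₃) := by
  obtain ⟨s, hs⟩ : ∃ s, s = minkowskiSq p₃ := ⟨_, rfl⟩
  rw [← hs] at h₃ hK ⊢
  set w := frameMap pauliMatrix p₃ with hw
  have hws : w 0 * w 3 - w 1 * w 2 = s := by
    rw [hs, ← splitForm_pauliMatrix]; rfl
  set y : Fin 4 → ℂ := ![w 3 / s, -w 1 / s, -w 2 / s, w 0 / s] with hy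
  have hys : splitForm y = 1 / s := by
    simp only [splitForm, hy, Matrix.cons_val]
    field_simp
    linear_combination hws
  have hform : ∀ {A : Type} [CommRing A] [Algebra ℂ A] (q : Fin 4 → A),
      minkowskiSq q = algebraMap ℂ A s * splitForm (frameMap (rightMulMatrix y * pauliMatrix) q) := by
    intro A _ _ q
    rw [frameMap_mul, splitForm_rightMulMatrix, splitForm_pauliMatrix, hys, ← mul_assoc, ← map_mul,
      mul_one_div_cancel h₃, map_one, one_mul]
  have hunit : frameMap (rightMulMatrix y * pauliMatrix) p₃ = unitVec := by
    rw [frameMap_mul, ← hw]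
    ext i
    fin_cases i
    all_goals
      simp [frameMap, rightMulMatrix, Fin.sum_univ_four, hy, unitVec]
      field_simp
      first
        | linear_combination hws
        | ring
  set v := frameMap (rightMulMatrix y * pauliMatrix) p₁ with hv
  obtain ⟨τ, hτ⟩ : ∃ τ : ℂ, v 1 + τ * (v 3 - v 0) - τ ^ 2 * v 2 ≠ 0 := by
    by_contra! hcon
    have e0 := hcon 0
    have e1 := hcon 1
    have e2 := hcon (-1)
    have v1 : v 1 = 0 := by linear_combination e0
    have v2 : v 2 = 0 := by linear_combination e0 - e1 / 2 - e2 / 2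
    have v3 : v 3 = v 0 := by linear_combination e1 / 2 - e2 / 2
    have hy₀ : minkowskiSq p₁ / s = v 0 ^ 2 := by
      rw [hform p₁, ← hv, splitForm, v1, v3, Algebra.algebraMap_self, RingHom.id_apply]
      field_simp
      ring
    have hz₀ : minkowskiSq p₂ / s = (v 0 + 1) ^ 2 := by
      have hp2 : p₂ = -(p₁ - -p₃) := by
        linear_combination hp
      have hneg : frameMap (rightMulMatrix y * pauliMatrix) (-p₃) = -unitVec := by
        rw [← hunit, ← zero_sub, frameMap_sub, ← zero_sub (frameMap _ p₃)]
        congr 1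
        ext i
        simp [frameMap]
      rw [hp2, minkowskiSq_neg, hform, frameMap_sub, ← hv, hneg, sub_neg_eq_add,
        Algebra.algebraMap_self, RingHom.id_apply]
      simp only [splitForm, unitVec, Pi.add_apply, Matrix.cons_val, v1, v3]
      field_simp
      ring
    rw [hy₀, hz₀, kallen_one_eq] at hK
    exact hK (by ring)
  refine ⟨conjMatrix τ * (rightMulMatrix y * pauliMatrix), ?_, ?_, ?_, ?_⟩
  · intro A _ _ q
    rw [frameMap_mul, splitForm_conjMatrix, ← hform]
  · rw [frameMap_mul, hunit]
    ext i
    fin_cases i <;> simp [frameMap, conjMatrix, Fin.sum_univ_four, unitVec]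
  · rw [frameMap_mul, ← hv]
    convert hτ using 1
    simp [frameMap, conjMatrix, Fin.sum_univ_four]
    ring
  · rw [Matrix.det_mul, Matrix.det_mul, det_conjMatrix, det_rightMulMatrix, hys, one_mul, mul_pow,
      det_pauliMatrix]
    field_simp

/-! ### The two leading singularities -/

theorem cutFactor_eq {L : ℕ} (hL : 1 ≤ L) (a₀ b₀ : ℂ) :
    cutFactor L a₀ b₀ = (a₀ - b₀) * (-1) ^ (L - 1) := by
  obtain ⟨L, rfl⟩ : ∃ L', L = L' + 1 := ⟨L - 1, by omega⟩
  simp [cutFactor, Fin.prod_univ_succ]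

theorem isLeadingSingularity_of_isEigenpair {L : ℕ} (hL : 1 ≤ L) {J : Matrix (Fin 4) (Fin 4) ℂ}
    {p₁ p₂ p₃ : Fin 4 → ℂ} {s : ℂ} (hs : s ≠ 0) (hJ : IsFrame J p₁ p₃ s) (hp : p₁ + p₂ + p₃ = 0)
    {a₀ b₀ : ℂ} (h₀ : IsEigenpair (fun μ => -frameMap J p₁ μ) a₀ b₀) (hab₀ : a₀ ≠ b₀) :
    IsUnit (ladderExponentMatrix L).det ∧
      IsLeadingSingularity (loopMeasure L) (ladderPropagator L p₁ p₂)
        ((1 / (Complex.I * (Real.pi : ℂ) ^ 2) / (s ^ 3 * J.det)) ^ L *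
          (cutFactor L a₀ b₀)⁻¹ * ((ladderExponentMatrix L).det : ℂ)) := by
  obtain ⟨hunit, F, hF, hlim⟩ := exists_flag hs hJ hp h₀ hab₀
  have hpi : (Real.pi : ℂ) ≠ 0 := by exact_mod_cast Real.pi_ne_zero
  have hne : (1 / (Complex.I * (Real.pi : ℂ) ^ 2) / (s ^ 3 * J.det)) ^ L *
          (cutFactor L a₀ b₀)⁻¹ * ((ladderExponentMatrix L).det : ℂ) ≠ 0 := by
    refine mul_ne_zero (mul_ne_zero (pow_ne_zero _ (div_ne_zero (one_div_ne_zero (mul_ne_zero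
      Complex.I_ne_zero (pow_ne_zero _ hpi))) (mul_ne_zero (pow_ne_zero _ hs) (hJ.det_ne_zero hs))))
      (inv_ne_zero ?_)) ?_
    · rw [cutFactor_eq hL]
      exact mul_ne_zero (sub_ne_zero.mpr hab₀) (pow_ne_zero _ (by norm_num))
    · exact_mod_cast hunit.ne_zero
  exact ⟨hunit, hne, F, hF, hlim.order_eq_zero hne, hlim.coeff_zero⟩

end

theorem theorem3 (L : ℕ) (hL : 1 ≤ L) (p₁ p₂ p₃ : Fin 4 → ℂ) (hp : p₁ + p₂ + p₃ = 0)
    (h₁ : minkowskiSq p₁ ≠ 0) (h₂ : minkowskiSq p₂ ≠ 0) (h₃ : minkowskiSq p₃ ≠ 0)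
    (hK : kallen 1 (minkowskiSq p₁ / minkowskiSq p₃) (minkowskiSq p₂ / minkowskiSq p₃) ≠ 0)
    (r : ℂ) :
    IsLeadingSingularity (loopMeasure L) (ladderPropagator L p₁ p₂) r ↔
      r = 1 / (4 * (Real.pi : ℂ) ^ 2) ^ L *
          (minkowskiSq p₃ ^ L *
            kallen 1 (minkowskiSq p₁ / minkowskiSq p₃) (minkowskiSq p₂ / minkowskiSq p₃)
              ^ (1 / 2 : ℂ))⁻¹ ∨
      r = -(1 / (4 * (Real.pi : ℂ) ^ 2) ^ L *
          (minkowskiSq p₃ ^ L *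
            kallen 1 (minkowskiSq p₁ / minkowskiSq p₃) (minkowskiSq p₂ / minkowskiSq p₃)
              ^ (1 / 2 : ℂ))⁻¹) := by
  obtain ⟨J, hJ⟩ := exists_isFrame hp h₃ hK
  have hρ : (kallen 1 (minkowskiSq p₁ / minkowskiSq p₃) (minkowskiSq p₂ / minkowskiSq p₃)
      ^ (1 / 2 : ℂ)) ^ 2 =
      kallen 1 (minkowskiSq p₁ / minkowskiSq p₃) (minkowskiSq p₂ / minkowskiSq p₃) := by
    rw [one_div]
    exact Complex.cpow_ofNat_inv_pow _ 2
  generalize kallen 1 (minkowskiSq p₁ / minkowskiSq p₃) (minkowskiSq p₂ / minkowskiSq p₃)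
      ^ (1 / 2 : ℂ) = ρ at *
  have hρ0 : ρ ≠ 0 := by
    rintro rfl
    exact hK (by rw [← hρ]; ring)
  rw [kallen_one_eq] at hρ
  have e1 : splitForm (fun μ => -frameMap J p₁ μ) = minkowskiSq p₁ / minkowskiSq p₃ := by
    rw [hJ.minkowskiSq_eq p₁, Algebra.algebraMap_self, RingHom.id_apply, mul_div_cancel_left₀ _ h₃]
    simp [splitForm]
  have e2 : splitForm ((fun μ => -frameMap J p₁ μ) - unitVec) =
      minkowskiSq p₂ / minkowskiSq p₃ := by
    have hp2 : p₂ = 0 - p₁ - p₃ := by linear_combination hp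
    have h0 : frameMap J (0 : Fin 4 → ℂ) = 0 := by ext; simp [frameMap]
    rw [hJ.minkowskiSq_eq p₂, Algebra.algebraMap_self, RingHom.id_apply, mul_div_cancel_left₀ _ h₃,
      hp2, frameMap_sub, frameMap_sub, hJ.map_third, h0, zero_sub]
    rfl
  generalize minkowskiSq p₃ = s at *
  generalize minkowskiSq p₁ / s = y₀ at *
  generalize minkowskiSq p₂ / s = z₀ at *
  have hE₁ : IsEigenpair (fun μ => -frameMap J p₁ μ) ((1 + y₀ - z₀ + ρ) / 2)
      ((1 + y₀ - z₀ - ρ) / 2) := by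
    apply isEigenpair_of_splitForm
    · rw [e1, e2]; ring
    · rw [e1]; linear_combination -hρ / 4
  have hE₂ : IsEigenpair (fun μ => -frameMap J p₁ μ) ((1 + y₀ - z₀ - ρ) / 2)
      ((1 + y₀ - z₀ + ρ) / 2) := by
    apply isEigenpair_of_splitForm
    · rw [e1, e2]; ring
    · rw [e1]; linear_combination -hρ / 4
  have hne₁ : (1 + y₀ - z₀ + ρ) / 2 ≠ (1 + y₀ - z₀ - ρ) / 2 := by
    intro h
    exact hρ0 (by linear_combination h)
  have hcut₁ : cutFactor L ((1 + y₀ - z₀ + ρ) / 2) ((1 + y₀ - z₀ - ρ) / 2) =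
      ρ * (-1) ^ (L - 1) := by
    rw [cutFactor_eq hL]; ring
  have hcut₂ : cutFactor L ((1 + y₀ - z₀ - ρ) / 2) ((1 + y₀ - z₀ + ρ) / 2) =
      -(ρ * (-1) ^ (L - 1)) := by
    rw [cutFactor_eq hL]; ring
  have hpi : (Real.pi : ℂ) ≠ 0 := by exact_mod_cast Real.pi_ne_zero
  have hdJ := hJ.det_ne_zero h₃
  -- Being a frame determines `det J` only up to its sign.
  have hκ : 1 / (Complex.I * (Real.pi : ℂ) ^ 2) / (s ^ 3 * J.det) = 1 / (4 * (Real.pi : ℂ) ^ 2 * s) ∨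
      1 / (Complex.I * (Real.pi : ℂ) ^ 2) / (s ^ 3 * J.det) =
        -(1 / (4 * (Real.pi : ℂ) ^ 2 * s)) := by
    rw [← sq_eq_sq_iff_eq_or_eq_neg, div_pow, div_pow, mul_pow, mul_pow, Complex.I_sq, hJ.det_sq]
    field_simp
    norm_num
  have hc : (1 / (Complex.I * (Real.pi : ℂ) ^ 2) / (s ^ 3 * J.det)) ^ L *
      (ρ * (-1) ^ (L - 1))⁻¹ = 1 / (4 * (Real.pi : ℂ) ^ 2) ^ L * (s ^ L * ρ)⁻¹ ∨
      (1 / (Complex.I * (Real.pi : ℂ) ^ 2) / (s ^ 3 * J.det)) ^ L *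
      (ρ * (-1) ^ (L - 1))⁻¹ = -(1 / (4 * (Real.pi : ℂ) ^ 2) ^ L * (s ^ L * ρ)⁻¹) := by
    have h1 : (1 / (4 * (Real.pi : ℂ) ^ 2 * s)) ^ L * ρ⁻¹ =
        1 / (4 * (Real.pi : ℂ) ^ 2) ^ L * (s ^ L * ρ)⁻¹ := by
      rw [div_pow, mul_pow, one_pow]
      field_simp
    rw [← h1]
    rcases hκ with h | h
    · rcases neg_one_pow_eq_or ℂ (L - 1) with h' | h' <;> rw [h, h'] <;> simp
    · rcases neg_one_pow_eq_or ℂ (L - 1) with h' | h' <;>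
        rcases neg_one_pow_eq_or ℂ L with h'' | h'' <;> rw [h, h', neg_pow, h''] <;> simp
  obtain ⟨hu, hls₁⟩ := isLeadingSingularity_of_isEigenpair hL h₃ hJ hp hE₁ hne₁
  obtain ⟨-, hls₂⟩ := isLeadingSingularity_of_isEigenpair hL h₃ hJ hp hE₂ hne₁.symm
  rw [hcut₁] at hls₁
  rw [hcut₂, inv_neg, mul_neg, neg_mul] at hls₂
  constructor
  · rintro ⟨hr, F, hF, -, hFr⟩
    obtain ⟨ε, hε⟩ := exists_unit_mul_of_cutsAll h₃ hJ hp hE₁ hne₁ hr F hF hFr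
    rw [hcut₁] at hε
    rw [hε]
    rcases hc with h | h <;> rcases Int.units_eq_one_or ε with h' | h' <;> rw [h, h'] <;> simp
  · rcases hc with h | h <;> rcases Int.isUnit_iff.mp hu with h' | h' <;>
      rw [h, h'] at hls₁ hls₂ <;> rintro (rfl | rfl) <;>
      first
        | simpa using hls₁
        | simpa using hls₂
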